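/- **Setting.** There are $N\ge 1$ agents, $R\ge 1$ identical resources and $K=\lceil N/R\rceil$ contexts; at time $t=0,1,2,\dots$ all agents observe the context $k_t = t \bmod K$, and $K$ consecutive time-steps (starting at a multiple of $K$) form an episode. In each time-step each agent yields (payoff $0$; while yielding he may monitor one resource and learn whether it is free, i.e. accessed by nobody) or accesses one resource; an access pays $1$ if nobody else accesses the same resource, and otherwise it is a collision and pays $\zeta<0$. Agents observe only the context and their own moves and feedback. Monitoring authorities enforce a quota: after a successful access an agent is denied access for the rest of the episode (an attempt then only counts as monitoring). For a strategy profile $(\sigma_n,\sigma_{-n})$ let $U_n(\sigma_n,\sigma_{-n},\delta)=\sum_{t\ge 0}\delta^t u_n(a^t)$ be the discounted payoff of agent $n$, where $u_n(a^t)$ is his payoff in step $t$ of the play. **Courteous strategy $\sigma^p$.** Agent $n$ keeps a table $g_n:\{0,\dots,K-1\}\to\{Y,A_1,\dots,A_R\}$, initially uniformly random. In context $k$: if $g_n(k)=A_r$ and he has had no successful access in the current episode, he accesses $r$, and in case of a collision sets $g_n(k)\leftarrow Y$ with probability $p$; if $g_n(k)=A_r$ and he has already had a successful access, he yields; if $g_n(k)=Y$,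 he monitors a uniformly random resource $r$ and sets $g_n(k)\leftarrow A_r$ if $r$ is free. All random choices are independent. **Theorem.** Let $\zeta<0$ and $0<p<1$. For every $\varepsilon>0$ there is $\delta_0\in(0,1)$ such that for all $\delta\in[\delta_0,1)$ and every agent $n$, $$\mathbb E[U_n(\sigma^p_n,\sigma^p_{-n},\delta)] > (1-\varepsilon)\,\mathbb E[U_n(\sigma^*_n,\sigma^p_{-n},\delta)],$$ where $\mathbb E[U_n(\sigma^*_n,\sigma^p_{-n},\delta)]$ denotes the best-response payoff, i.e. the (finite) supremum of $\mathbb E[U_n(\sigma_n,\sigma^p_{-n},\delta)]$ over all strategies $\sigma_n$ of agent $n$ (randomised and depending on his own history). Moreover $\sigma^p$ is an $\varepsilon$-approximate subgame-perfect equilibrium: with the same $\delta_0$, the same inequality holds for the continuation game starting at any time $s$, whatever the current tables $g_1,\dots,g_N$ and the current records of who has already had a successful access in the current episode, the discounted payoffs and the best-response payoff being those of the continuation game. -/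

import Mathlib

open MeasureTheory ProbabilityTheory

noncomputable section

namespace Allocation

/-! ### The stage game -/

/-- What an agent does in one time-step: yield, yield while monitoring a resource, or access a
resource. The last two kinds carry the resource. -/
inductive Move (R : ℕ) where
  | yield : Move R
  | monitor (r : Fin R) : Move R
  | access (r : Fin R) : Move R

/-- What an agent is told at the end of a time-step: success or collision if he accessed a
resource, free or occupied if he monitored one, nothing if he merely yielded. -/
inductive Feedback where
  | nothing : Feedback
  | free : Feedback
  | occupied : Feedback
  | success : Feedback
  | collision : Feedback

open Classical in
/-- The stage payoff of agent `n` under the joint move `a`: `0` for yielding (with or without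
monitoring), `1` for a successful access, `ζ` for a collision. -/
def stagePayoff {N R : ℕ} (ζ : ℝ) (a : Fin N → Move R) (n : Fin N) : ℝ :=
  match a n with
  | Move.access r => if ∃ j, j ≠ n ∧ a j = Move.access r then ζ else 1
  | _ => 0

open Classical in
/-- The feedback of agent `n` under the joint move `a`. A resource is free if nobody accesses it. -/
def feedback {N R : ℕ} (a : Fin N → Move R) (n : Fin N) : Feedback :=
  match a n with
  | Move.yield => Feedback.nothing
  | Move.monitor r => if ∃ j, a j = Move.access r then Feedback.occupied else Feedback.free
  | Move.access r =>
      if ∃ j, j ≠ n ∧ a j = Move.access r then Feedback.collision else Feedback.success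

/-! ### Monitoring authorities and quotas -/

/-- The quota. The authorities keep, for every agent, a flag telling whether he has already had a
successful access in the current episode. While the flag is up they deny access: an attempt to
access a resource then only counts as monitoring it. -/
def enforceQuota {R : ℕ} (accessed : Bool) (a : Move R) : Move R :=
  match a with
  | Move.access r => if accessed then Move.monitor r else Move.access r
  | a => a

open Classical in
/-- The flags after the time-step `t`, in which the joint move `a` was executed. An episode consists
of `K` consecutive time-steps, the first one starting at time `0`; all flags are lowered at the end
of each episode. -/
def nextFlags {N R : ℕ} (K t : ℕ) (accessed : Fin N → Bool) (a : Fin N → Move R) : Fin N → Bool :=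
  fun n =>
    if K ∣ t + 1 then false
    else if feedback a n = Feedback.success then true else accessed n

/-- The common context observed at time `t`: the `K` contexts repeat periodically. -/
def context (K : ℕ) [NeZero K] (t : ℕ) : Fin K := Fin.ofNat K t

/-! ### Strategies -/

/-- A strategy of one agent in the repeated game: a private memory of any kind (for instance the
agent's whole own history), its random initial value, the random choice of a move given
the memory, the current context and the agent's own flag, and the random update of the memory given
the context, the move that he executed and the feedback that he received. -/
structure Strategy (R K : ℕ) where
  Mem : Type
  init : PMF Mem
  act : Mem → Fin K → Bool → PMF (Move R)
  update : Mem → Fin K → Move R → Feedback → PMF Mem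

/-- The coin that shows `true` with probability `p`. -/
def coin (p : ℝ) (hp0 : 0 ≤ p) (hp1 : p ≤ 1) : PMF Bool :=
  PMF.ofFintype (fun b => if b then ENNReal.ofReal p else ENNReal.ofReal (1 - p)) (by
    simp [← ENNReal.ofReal_add hp0 (sub_nonneg.2 hp1)])

/-- The table `g` of a courteous agent: for each context either a resource or `none` (yield). -/
abbrev Table (R K : ℕ) := Fin K → Option (Fin R)

/-- The courteous strategy with back-off probability `p`, started from a table drawn from `ι`.
In context `k` with `g k = some r` he accesses `r`, unless he has already had his access in this
episode; after a collision he sets `g k` to `none` with probability `p`. With `g k = none` he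
monitors a uniformly random resource `r`, and sets `g k` to `some r` if it is free. -/
def courteousFrom {R K : ℕ} [NeZero R] (p : ℝ) (hp0 : 0 ≤ p) (hp1 : p ≤ 1)
    (ι : PMF (Table R K)) : Strategy R K where
  Mem := Table R K
  init := ι
  act g k accessed :=
    match g k with
    | some r => PMF.pure (if accessed then Move.yield else Move.access r)
    | none => (PMF.uniformOfFintype (Fin R)).map Move.monitor
  update g k a f :=
    match a, f with
    | Move.access _, Feedback.collision =>
        (coin p hp0 hp1).map fun b => if b then Function.update g k none else g
    | Move.monitor r, Feedback.free => PMF.pure (Function.update g k (some r))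
    | _, _ => PMF.pure g

/-- The courteous strategy: the initial table is uniformly random. -/
def courteous (R K : ℕ) [NeZero R] (p : ℝ) (hp0 : 0 ≤ p) (hp1 : p ≤ 1) : Strategy R K :=
  courteousFrom p hp0 hp1 (PMF.uniformOfFintype (Table R K))

/-! ### The play of a strategy profile -/

theorem tsum_prod_pmf : ∀ {N : ℕ} {α : Fin N → Type} (f : ∀ i, PMF (α i)),
    ∑' x : (∀ i, α i), ∏ i, f i (x i) = 1
  | 0, _, _ => by simp
  | N + 1, α, f => by
      rw [← (Fin.consEquiv α).tsum_eq, ENNReal.tsum_prod']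
      simp only [Fin.consEquiv_apply, Fin.prod_univ_succ, Fin.cons_zero, Fin.cons_succ,
        ENNReal.tsum_mul_left, tsum_prod_pmf (fun i => f (Fin.succ i)), mul_one]
      exact (f 0).tsum_coe

/-- Independent sampling: the product of finitely many discrete distributions. -/
def independent {N : ℕ} {α : Fin N → Type} (f : ∀ i, PMF (α i)) : PMF (∀ i, α i) :=
  ⟨fun x => ∏ i, f i (x i), tsum_prod_pmf f ▸ ENNReal.summable.hasSum⟩

/-- The situation in one time-step: the memories of all agents, the flags kept by
the authorities, and the joint move that is executed. -/
structure Stage {N R K : ℕ} (σ : Fin N → Strategy R K) where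
  memory : ∀ i, (σ i).Mem
  accessed : Fin N → Bool
  moves : Fin N → Move R

instance {N R K : ℕ} (σ : Fin N → Strategy R K) : MeasurableSpace (Stage σ) := ⊤

/-- The agents choose their moves at time `t`, independently of each other given the memories, and
the quota is enforced. -/
def chooseMoves {N R K : ℕ} [NeZero K] (σ : Fin N → Strategy R K) (t : ℕ)
    (m : ∀ i, (σ i).Mem) (accessed : Fin N → Bool) : PMF (Stage σ) :=
  (independent fun i =>
    ((σ i).act (m i) (context K t) (accessed i)).map (enforceQuota (accessed i))).map
      fun a => ⟨m, accessed, a⟩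

/-- The law of the first time-step, when the play starts at time `s` with the given flags. -/
def firstStage {N R K : ℕ} [NeZero K] (σ : Fin N → Strategy R K) (s : ℕ)
    (accessed : Fin N → Bool) : PMF (Stage σ) :=
  (independent fun i => (σ i).init).bind fun m => chooseMoves σ s m accessed

/-- The conditional law of time-step `t + 1` given time-step `t`. -/
def nextStage {N R K : ℕ} [NeZero K] (σ : Fin N → Strategy R K) (t : ℕ) (x : Stage σ) :
    PMF (Stage σ) :=
  (independent fun i =>
    (σ i).update (x.memory i) (context K t) (x.moves i) (feedback x.moves i)).bind
      fun m => chooseMoves σ (t + 1) m (nextFlags K t x.accessed x.moves)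

/-- `nextStage` as a transition kernel from the past of the play; the play starts at time `s`,
so its step number `t` takes place at time `s + t`. -/
def stepKernel {N R K : ℕ} [NeZero K] (σ : Fin N → Strategy R K) (s t : ℕ) :
    Kernel ((i : Finset.Iic t) → (fun _ : ℕ => Stage σ) i) ((fun _ : ℕ => Stage σ) (t + 1)) where
  toFun x := (nextStage σ (s + t) (x ⟨t, Finset.mem_Iic.2 le_rfl⟩)).toMeasure
  measurable' :=
    (measurable_from_top (f := fun y : Stage σ => (nextStage σ (s + t) y).toMeasure)).comp
      (measurable_pi_apply _)

instance {N R K : ℕ} [NeZero K] (σ : Fin N → Strategy R K) (s t : ℕ) :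
    IsMarkovKernel (stepKernel σ s t) :=
  ⟨fun x => by
    change IsProbabilityMeasure (nextStage σ (s + t) _).toMeasure
    infer_instance⟩

/-- The law of the infinite play of the profile `σ`, started at time `s` with the given flags. -/
def playLaw {N R K : ℕ} [NeZero K] (σ : Fin N → Strategy R K) (s : ℕ) (accessed : Fin N → Bool) :
    Measure (ℕ → Stage σ) :=
  Kernel.trajMeasure (X := fun _ => Stage σ) (firstStage σ s accessed).toMeasure (stepKernel σ s)

/-- The cumulative discounted payoff of agent `n` along a play. -/
def discountedPayoff {N R K : ℕ} {σ : Fin N → Strategy R K} (ζ δ : ℝ) (n : Fin N)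
    (ω : ℕ → Stage σ) : ℝ :=
  ∑' t : ℕ, δ ^ t * stagePayoff ζ (ω t).moves n

/-- The expected cumulative discounted payoff of agent `n` when the profile `σ` is played from
time `s` on, starting with the given flags. -/
def expectedPayoff {N R K : ℕ} [NeZero K] (ζ δ : ℝ) (s : ℕ) (accessed : Fin N → Bool)
    (σ : Fin N → Strategy R K) (n : Fin N) : ℝ :=
  ∫ ω, discountedPayoff ζ δ n ω ∂(playLaw σ s accessed)

/-! ### Approximate equilibrium -/

/-- In the profile `σ`, agent `n` gets more than `1 - ε` times his best-response payoff. The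
best-response payoff is the least upper bound `V` of what he gets with any strategy `τ` against
the strategies of the others; a best-response strategy is one that attains `V`. -/
def IsApproxBestResponse {N R K : ℕ} [NeZero K] (ζ δ ε : ℝ) (s : ℕ) (accessed : Fin N → Bool)
    (σ : Fin N → Strategy R K) (n : Fin N) : Prop :=
  ∃ V : ℝ,
    IsLUB (Set.range fun τ : Strategy R K =>
      expectedPayoff ζ δ s accessed (Function.update σ n τ) n) V ∧
    expectedPayoff ζ δ s accessed σ n > (1 - ε) * V

end Allocation

end

/-! The quota allows at most one success per episode, so every strategy earns at most
$1+1/(1-\delta^K)$ (`expectedPayoff_le`). It is enough that courteous play earns at least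
$\delta^{2K-1}/(1-\delta^K)-C$ with $C$ independent of $\delta$, the starting time, the tables and
the flags: multiplied by $1-\delta^K$, both bounds tend to $1$ as $\delta\to1$ (`exists_discount`).

For the lower bound, the context, the tables and the flags of courteous agents form a finite Markov
chain. Only the first nonempty entry of a table matters once things are in order: after the success
there, the quota makes the later entries of that episode harmless. In a settled state these first
entries are distinct slots, everybody has one, and nobody still waiting for his slot finds a free
resource. Settled states are closed under the chain (`Settled.chain`) and give each agent one
success per episode. They can be reached from every state (`exists_leads_settled`): contexts are
stabilised in increasing order, since stability at a context involves no later one, and $N\le KR$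
leaves a slot for everybody. Finiteness then yields a bounded $h\ge0$ that falls by at least $1$ on
average in each unsettled step (`exists_lyapunov`), which bounds the expected time to settle. An
unsettled step costs at most $1-\zeta$, so $C=(1-\zeta)H$ with $H\ge h$.

Both bounds are one-step inequalities for a potential (`expect_le_integral_discounted`): minus
`earlyValue` for the upper bound, `lateValue` minus $(1-\zeta)h$ for the lower one. -/

noncomputable section

namespace Allocation

set_option linter.unusedSectionVars false

/-! ### Expectations of bounded functions under discrete distributions -/

/-- The expectation of a real function under a discrete distribution. -/
def expect {α : Type*} (q : PMF α) (f : α → ℝ) : ℝ := ∑' a, (q a).toReal * f a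

section Expect

variable {α β : Type*} (q : PMF α) {f g : α → ℝ} {B C : ℝ}

theorem hasSum_toReal : HasSum (fun a => (q a).toReal) 1 := by
  have h := ENNReal.hasSum_toReal q.tsum_coe_ne_top
  rwa [← ENNReal.tsum_toReal_eq q.apply_ne_top, q.tsum_coe, ENNReal.toReal_one] at h

theorem summable_expect (hf : ∀ a, |f a| ≤ B) : Summable fun a => (q a).toReal * f a := by
  refine Summable.of_norm_bounded ((hasSum_toReal q).summable.mul_right B) fun a => ?_
  rw [Real.norm_eq_abs, abs_mul, abs_of_nonneg ENNReal.toReal_nonneg]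
  exact mul_le_mul_of_nonneg_left (hf a) ENNReal.toReal_nonneg

theorem expect_const (b : ℝ) : expect q (fun _ => b) = b := by
  simp [expect, tsum_mul_right, (hasSum_toReal q).tsum_eq]

/-- The comparison is needed on the support only, so expectations can be bounded by inspecting which
moves and updates are possible. -/
theorem expect_mono (hf : ∀ a, |f a| ≤ B) (hg : ∀ a, |g a| ≤ C)
    (h : ∀ a ∈ q.support, f a ≤ g a) : expect q f ≤ expect q g := by
  refine (summable_expect q hf).tsum_le_tsum (fun a => ?_) (summable_expect q hg)
  by_cases ha : a ∈ q.support
  · exact mul_le_mul_of_nonneg_left (h a ha) ENNReal.toReal_nonneg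
  · simp [(q.apply_eq_zero_iff a).2 ha]

theorem le_expect {b : ℝ} (hf : ∀ a, |f a| ≤ B) (h : ∀ a ∈ q.support, b ≤ f a) :
    b ≤ expect q f := by
  simpa only [expect_const] using expect_mono q (f := fun _ => b) (fun _ => le_rfl) hf h

theorem expect_le {b : ℝ} (hf : ∀ a, |f a| ≤ B) (h : ∀ a ∈ q.support, f a ≤ b) :
    expect q f ≤ b := by
  simpa only [expect_const] using expect_mono q (g := fun _ => b) hf (fun _ => le_rfl) h

theorem abs_expect_le (hf : ∀ a, |f a| ≤ B) : |expect q f| ≤ B :=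
  abs_le.2 ⟨le_expect q hf fun a _ => (abs_le.1 (hf a)).1,
    expect_le q hf fun a _ => (abs_le.1 (hf a)).2⟩

theorem expect_add (hf : ∀ a, |f a| ≤ B) (hg : ∀ a, |g a| ≤ C) :
    expect q (fun a => f a + g a) = expect q f + expect q g := by
  simp only [expect, mul_add]
  exact (summable_expect q hf).tsum_add (summable_expect q hg)

theorem expect_mul_left (b : ℝ) : expect q (fun a => b * f a) = b * expect q f := by
  simp only [expect, ← tsum_mul_left]
  exact tsum_congr fun a => by ring

theorem expect_mul_add_mul (hf : ∀ a, |f a| ≤ B) (hg : ∀ a, |g a| ≤ C) (r s : ℝ) :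
    expect q (fun a => r * f a + s * g a) = r * expect q f + s * expect q g := by
  have hmul : ∀ {u : α → ℝ} {D : ℝ} (b : ℝ), (∀ a, |u a| ≤ D) → ∀ a, |b * u a| ≤ |b| * D :=
    fun b hu a => by
      rw [abs_mul]
      exact mul_le_mul_of_nonneg_left (hu a) (abs_nonneg b)
  rw [expect_add q (f := fun a => r * f a) (g := fun a => s * g a) (hmul r hf) (hmul s hg),
    expect_mul_left, expect_mul_left]

theorem expect_pure (a : α) (f : α → ℝ) : expect (PMF.pure a) f = f a := by
  rw [expect, tsum_eq_single a]
  · simp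
  · intro b hb
    simp [PMF.pure_apply_of_ne _ _ hb]

theorem expect_bind (κ : α → PMF β) {f : β → ℝ} (hf : ∀ b, |f b| ≤ B) :
    expect (q.bind κ) f = expect q fun a => expect (κ a) f := by
  -- Boundedness of `f` makes the double series absolutely summable, which permits exchanging the
  -- two sums.
  have hs : Summable fun x : α × β => (q x.1).toReal * ((κ x.1 x.2).toReal * f x.2) := by
    have h0 : ∀ x : α × β, 0 ≤ (q x.1).toReal * (κ x.1 x.2).toReal := fun x =>
      mul_nonneg ENNReal.toReal_nonneg ENNReal.toReal_nonneg
    have hB : Summable fun x : α × β => (q x.1).toReal * (κ x.1 x.2).toReal := by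
      refine (summable_prod_of_nonneg h0).2 ⟨fun a => ?_, ?_⟩
      · exact (hasSum_toReal (κ a)).summable.mul_left (q a).toReal
      · simpa only [tsum_mul_left, (hasSum_toReal _).tsum_eq, mul_one]
          using (hasSum_toReal q).summable
    refine Summable.of_norm_bounded (hB.mul_right B) fun x => ?_
    rw [Real.norm_eq_abs, ← mul_assoc, abs_mul, abs_of_nonneg (h0 x)]
    exact mul_le_mul_of_nonneg_left (hf _) (h0 x)
  have hswap := hs.tsum_comm (f := fun a b => (q a).toReal * ((κ a b).toReal * f b))
  simp only [expect, ← tsum_mul_left]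
  rw [← hswap]
  refine tsum_congr fun b => ?_
  rw [PMF.bind_apply, ENNReal.tsum_toReal_eq fun a =>
    ENNReal.mul_ne_top (q.apply_ne_top a) ((κ a).apply_ne_top b), ← tsum_mul_right]
  exact tsum_congr fun a => by rw [ENNReal.toReal_mul, mul_assoc]

theorem expect_map (φ : α → β) {f : β → ℝ} (hf : ∀ b, |f b| ≤ B) :
    expect (q.map φ) f = expect q fun a => f (φ a) := by
  rw [← PMF.bind_pure_comp, expect_bind q _ hf]
  simp only [Function.comp_apply, expect_pure]

theorem integral_toMeasure [MeasurableSpace α] [DiscreteMeasurableSpace α]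
    (hf : ∀ a, |f a| ≤ B) : ∫ a, f a ∂q.toMeasure = expect q f :=
  q.integral_eq_tsum f <| .of_bound (Measurable.of_discrete.aestronglyMeasurable) B
    (.of_forall hf)

end Expect

/-! ### One-step analysis of the infinite play -/

section Play

variable {N R K : ℕ} [NeZero K] (σ : Fin N → Strategy R K) (s : ℕ) (accessed : Fin N → Bool)

instance : DiscreteMeasurableSpace (Stage σ) := ⟨fun _ => trivial⟩

instance : IsProbabilityMeasure (playLaw σ s accessed) := by
  unfold playLaw; infer_instance

variable {σ} in
theorem integrable_play {f : Stage σ → ℝ} {B : ℝ} (hf : ∀ x, |f x| ≤ B) (t : ℕ) :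
    Integrable (fun ω : ℕ → Stage σ => f (ω t)) (playLaw σ s accessed) :=
  .of_bound ((Measurable.of_discrete (f := f)).comp
    (measurable_pi_apply t)).aestronglyMeasurable B (.of_forall fun ω => hf (ω t))

theorem map_eval_zero_playLaw :
    (playLaw σ s accessed).map (fun ω => ω 0) = (firstStage σ s accessed).toMeasure := by
  -- The coordinate at `0` factors through the restriction to `Finset.Iic 0`, whose law is the
  -- initial measure.
  have h : (fun ω : ℕ → Stage σ => ω 0) =
      (MeasurableEquiv.piUnique (fun i : Finset.Iic 0 => (fun _ : ℕ => Stage σ) i)) ∘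
        Preorder.frestrictLe (π := fun _ : ℕ => Stage σ) 0 := rfl
  rw [h, ← Measure.map_map (by fun_prop) (by fun_prop), playLaw, Kernel.trajMeasure,
    Measure.map_comp _ _ (by fun_prop), Kernel.traj_map_frestrictLe, Kernel.partialTraj_self,
    Measure.id_comp, Measure.map_map (by fun_prop) (by fun_prop)]
  exact Measure.map_id

theorem integral_play_zero {f : Stage σ → ℝ} {B : ℝ} (hf : ∀ x, |f x| ≤ B) :
    ∫ ω, f (ω 0) ∂(playLaw σ s accessed) = expect (firstStage σ s accessed) f := by
  rw [← integral_toMeasure _ hf, ← map_eval_zero_playLaw,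
    integral_map (measurable_pi_apply 0).aemeasurable
      Measurable.of_discrete.aestronglyMeasurable]

/-- The Markov property: the joint law of the past up to `t` and the next stage is the law of the
past composed with `stepKernel`, which looks only at stage `t`. -/
theorem integral_play_succ {f : Stage σ → ℝ} {B : ℝ} (hf : ∀ x, |f x| ≤ B) (t : ℕ) :
    ∫ ω, f (ω (t + 1)) ∂(playLaw σ s accessed) =
      ∫ ω, expect (nextStage σ (s + t) (ω t)) f ∂(playLaw σ s accessed) := by
  have hm : Measurable f := Measurable.of_discrete
  have hmap := Kernel.map_frestrictLe_trajMeasure_compProd_eq_map_trajMeasure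
    (X := fun _ : ℕ => Stage σ) (μ₀ := (firstStage σ s accessed).toMeasure)
    (κ := stepKernel σ s) (a := t)
  have hr : Measurable (Preorder.frestrictLe (π := fun _ : ℕ => Stage σ) t) := by fun_prop
  have hp : Measurable fun x : ℕ → Stage σ =>
      (Preorder.frestrictLe (π := fun _ : ℕ => Stage σ) t x, x (t + 1)) := by fun_prop
  have h1 : ∫ ω, f (ω (t + 1)) ∂(playLaw σ s accessed) =
      ∫ z, f z.2 ∂((playLaw σ s accessed).map fun x : ℕ → Stage σ =>
        (Preorder.frestrictLe (π := fun _ : ℕ => Stage σ) t x, x (t + 1))) :=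
    (integral_map hp.aemeasurable (hm.comp measurable_snd).aestronglyMeasurable).symm
  have hP : IsProbabilityMeasure ((playLaw σ s accessed).map
      (Preorder.frestrictLe (π := fun _ : ℕ => Stage σ) t)) :=
    Measure.isProbabilityMeasure_map hr.aemeasurable
  rw [h1, playLaw, ← hmap]
  change ∫ z, f z.2 ∂(((playLaw σ s accessed).map
      (Preorder.frestrictLe (π := fun _ : ℕ => Stage σ) t)) ⊗ₘ (stepKernel σ s t)) = _
  have hint := Measure.integral_compProd (f := fun z : _ × Stage σ => f z.2)
    (μ := (playLaw σ s accessed).map (Preorder.frestrictLe (π := fun _ : ℕ => Stage σ) t))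
    (κ := stepKernel σ s t) (.of_bound (hm.comp measurable_snd).aestronglyMeasurable B
      (.of_forall fun z => hf z.2))
  refine hint.trans ?_
  rw [integral_map hr.aemeasurable]
  · refine integral_congr_ae (.of_forall fun ω => ?_)
    exact integral_toMeasure _ hf
  · exact (StronglyMeasurable.integral_kernel_prod_right'
      (hm.comp measurable_snd).stronglyMeasurable).aestronglyMeasurable

/-! ### Discounted sums of bounded rewards -/

theorem summable_discounted {c : ℕ → ℝ} {C δ : ℝ} (hc : ∀ t, |c t| ≤ C) (hδ0 : 0 ≤ δ)
    (hδ1 : δ < 1) : Summable fun t => δ ^ t * c t := by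
  refine Summable.of_norm_bounded ((summable_geometric_of_lt_one hδ0 hδ1).mul_right C) fun t => ?_
  rw [Real.norm_eq_abs, abs_mul, abs_of_nonneg (by positivity)]
  exact mul_le_mul_of_nonneg_left (hc t) (by positivity)

/-- Iterating the inequality `T` times leaves the remainder `δ ^ T * a T`, which vanishes because
`a` is bounded. -/
theorem le_tsum_discounted {a c : ℕ → ℝ} {B C δ : ℝ} (ha : ∀ t, |a t| ≤ B) (hc : ∀ t, |c t| ≤ C)
    (hδ0 : 0 ≤ δ) (hδ1 : δ < 1) (h : ∀ t, a t ≤ c t + δ * a (t + 1)) :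
    a 0 ≤ ∑' t, δ ^ t * c t := by
  have hT : ∀ T, a 0 ≤ ∑ t ∈ Finset.range T, δ ^ t * c t + δ ^ T * a T := by
    intro T
    induction T with
    | zero => simp
    | succ T ih =>
      rw [Finset.sum_range_succ, pow_succ]
      nlinarith [mul_le_mul_of_nonneg_left (h T) (pow_nonneg hδ0 T)]
  have h0 : Filter.Tendsto (fun T => δ ^ T * a T) Filter.atTop (nhds 0) :=
    (summable_discounted ha hδ0 hδ1).tendsto_atTop_zero
  have h1 := (summable_discounted hc hδ0 hδ1).hasSum.tendsto_sum_nat.add h0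
  rw [add_zero] at h1
  exact ge_of_tendsto' h1 hT

variable {σ} in
theorem integral_discounted {c : Stage σ → ℝ} {C δ : ℝ} (hc : ∀ x, |c x| ≤ C)
    (hδ0 : 0 ≤ δ) (hδ1 : δ < 1) :
    ∫ ω, ∑' t : ℕ, δ ^ t * c (ω t) ∂(playLaw σ s accessed) =
      ∑' t : ℕ, δ ^ t * ∫ ω, c (ω t) ∂(playLaw σ s accessed) := by
  simp only [← integral_const_mul]
  refine (integral_tsum_of_summable_integral_norm
    (fun t => (integrable_play s accessed hc t).const_mul _) ?_).symm
  refine Summable.of_nonneg_of_le (fun t => integral_nonneg fun ω => norm_nonneg _) (fun t => ?_)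
    ((summable_geometric_of_lt_one hδ0 hδ1).mul_right C)
  have h := integral_mono ((integrable_play s accessed hc t).const_mul (δ ^ t)).norm
    (integrable_const (δ ^ t * C)) (μ := playLaw σ s accessed) fun ω => by
      rw [Real.norm_eq_abs, abs_mul, abs_of_nonneg (by positivity)]
      exact mul_le_mul_of_nonneg_left (hc _) (by positivity)
  simpa using h

/-- A bounded function `W` of time, memories and flags that is at most the expected reward of one
step plus the discounted value of `W` after that step is a lower bound for the expected
discounted sum of the rewards. -/
theorem expect_le_integral_discounted {c : Stage σ → ℝ} {C δ : ℝ} (hc : ∀ x, |c x| ≤ C)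
    (hδ0 : 0 ≤ δ) (hδ1 : δ < 1) {W : ℕ → (∀ i, (σ i).Mem) → (Fin N → Bool) → ℝ} {B : ℝ}
    (hB : ∀ t m a, |W t m a| ≤ B)
    (hW : ∀ t m a, W t m a ≤ expect (chooseMoves σ t m a) fun x : Stage σ =>
      c x + δ * expect (independent fun i =>
        (σ i).update (x.memory i) (context K t) (x.moves i) (feedback x.moves i))
          fun m' => W (t + 1) m' (nextFlags K t x.accessed x.moves)) :
    expect (independent fun i => (σ i).init) (fun m => W s m accessed) ≤
      ∫ ω, ∑' t : ℕ, δ ^ t * c (ω t) ∂(playLaw σ s accessed) := by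
  -- `W` is a value before the moves are drawn; `w` is the corresponding value once they are known,
  -- hence a function of the stage, to which the Markov property applies.
  set w : ℕ → Stage σ → ℝ := fun t x =>
    c x + δ * expect (independent fun i =>
        (σ i).update (x.memory i) (context K t) (x.moves i) (feedback x.moves i))
          fun m' => W (t + 1) m' (nextFlags K t x.accessed x.moves) with hw
  have hE : ∀ (t : ℕ) (x : Stage σ), |expect (independent fun i =>
        (σ i).update (x.memory i) (context K t) (x.moves i) (feedback x.moves i))
          fun m' => W (t + 1) m' (nextFlags K t x.accessed x.moves)| ≤ B :=
    fun t x => abs_expect_le _ fun m' => hB _ _ _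
  have hwB : ∀ t x, |w t x| ≤ C + δ * B := fun t x => by
    refine (abs_add_le _ _).trans (add_le_add (hc x) ?_)
    rw [abs_mul, abs_of_nonneg hδ0]
    exact mul_le_mul_of_nonneg_left (hE t x) hδ0
  have hstart : expect (independent fun i => (σ i).init) (fun m => W s m accessed) ≤
      ∫ ω, w (s + 0) (ω 0) ∂(playLaw σ s accessed) := by
    rw [integral_play_zero σ s accessed (hwB _), firstStage, expect_bind _ _ (hwB _)]
    exact expect_mono _ (fun m => hB _ _ _) (fun m => abs_expect_le _ (hwB _))
      fun m _ => hW s m accessed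
  refine hstart.trans ?_
  rw [integral_discounted s accessed hc hδ0 hδ1]
  have habs : ∀ {f : Stage σ → ℝ} {D : ℝ}, (∀ x, |f x| ≤ D) → ∀ t,
      |∫ ω, f (ω t) ∂(playLaw σ s accessed)| ≤ D := fun {f D} hf t => by
    simpa using norm_integral_le_of_norm_le_const (μ := playLaw σ s accessed)
      (f := fun ω => f (ω t)) (C := D) (.of_forall fun ω => hf (ω t))
  refine le_tsum_discounted (a := fun t => ∫ ω, w (s + t) (ω t) ∂(playLaw σ s accessed))
    (fun t => habs (hwB _) t) (fun t => habs hc t) hδ0 hδ1 fun t => ?_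
  have hnext : ∀ x : Stage σ, |expect (nextStage σ (s + t) x) (w (s + (t + 1)))| ≤ C + δ * B :=
    fun x => abs_expect_le _ (hwB _)
  simp only [integral_play_succ σ s accessed (hwB _)]
  rw [← integral_const_mul, ← integral_add (integrable_play s accessed hc t)
    ((integrable_play s accessed hnext t).const_mul δ)]
  refine integral_mono (integrable_play s accessed (hwB _) t)
    ((integrable_play s accessed hc t).add ((integrable_play s accessed hnext t).const_mul δ))
    fun ω => ?_
  refine add_le_add_right (mul_le_mul_of_nonneg_left ?_ hδ0) _
  rw [nextStage, expect_bind _ _ (hwB _)]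
  exact expect_mono _ (fun m => hB _ _ _) (fun m => abs_expect_le _ (hwB _))
    fun m _ => hW (s + t + 1) m _

end Play

theorem mem_support_independent {N : ℕ} {α : Fin N → Type} (f : ∀ i, PMF (α i))
    (x : ∀ i, α i) : x ∈ (independent f).support ↔ ∀ i, x i ∈ (f i).support := by
  change ∏ i, f i (x i) ≠ 0 ↔ _
  simp [Finset.prod_ne_zero_iff]

theorem mem_support_chooseMoves {N R K : ℕ} [NeZero K] (σ : Fin N → Strategy R K) (t : ℕ)
    (m : ∀ i, (σ i).Mem) (acc : Fin N → Bool) (x : Stage σ) :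
    x ∈ (chooseMoves σ t m acc).support ↔ x.memory = m ∧ x.accessed = acc ∧
      ∀ i, ∃ b ∈ ((σ i).act (m i) (context K t) (acc i)).support,
        enforceQuota (acc i) b = x.moves i := by
  simp only [chooseMoves, PMF.mem_support_map_iff, mem_support_independent]
  constructor
  · rintro ⟨a, ha, rfl⟩
    exact ⟨rfl, rfl, ha⟩
  · rintro ⟨rfl, rfl, h⟩
    exact ⟨x.moves, h, rfl⟩

/-! ### Payoff and feedback -/

section Stage

variable {N R : ℕ} {ζ : ℝ} (hζ : ζ < 0) (a : Fin N → Move R) (n : Fin N)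

include hζ in
theorem abs_stagePayoff_le : |stagePayoff ζ a n| ≤ 1 - ζ := by
  unfold stagePayoff
  split
  · split_ifs
    · rw [abs_of_neg hζ]; linarith
    · rw [abs_one]; linarith
  · rw [abs_zero]; linarith

include hζ in
theorem le_stagePayoff : ζ ≤ stagePayoff ζ a n := by
  unfold stagePayoff
  split
  · split_ifs <;> linarith
  · exact hζ.le

variable {a n}

theorem stagePayoff_eq_zero (h : ∀ r, a n ≠ Move.access r) : stagePayoff ζ a n = 0 := by
  unfold stagePayoff
  split
  · exact absurd ‹_› (h _)
  · rfl

theorem feedback_eq_success_iff : feedback a n = Feedback.success ↔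
    ∃ r, a n = Move.access r ∧ ∀ j, j ≠ n → a j ≠ Move.access r := by
  unfold feedback
  split
  · simp [*]
  · split_ifs <;> simp [*]
  · rename_i r hr
    split_ifs with h
    · obtain ⟨j, hj⟩ := h
      simp only [hr, false_iff]
      rintro ⟨r', hr', h'⟩
      cases hr'
      exact h' j hj.1 hj.2
    · simp only [true_iff]
      exact ⟨r, hr, fun j hj hj' => h ⟨j, hj, hj'⟩⟩

theorem stagePayoff_of_success (h : feedback a n = Feedback.success) :
    stagePayoff ζ a n = 1 := by
  obtain ⟨r, hr, h⟩ := feedback_eq_success_iff.1 h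
  rw [stagePayoff, hr]
  exact if_neg fun ⟨j, hj, hj'⟩ => h j hj hj'

include hζ in
theorem stagePayoff_nonpos (h : feedback a n ≠ Feedback.success) : stagePayoff ζ a n ≤ 0 := by
  unfold stagePayoff
  split
  · rename_i r hr
    split_ifs with hj
    · exact hζ.le
    · exact absurd (feedback_eq_success_iff.2 ⟨r, hr, fun j h1 h2 => hj ⟨j, h1, h2⟩⟩) h
  · exact le_rfl

end Stage

/-! ### The quota bounds every payoff -/

theorem mod_add_one_of_dvd {K t : ℕ} (hK : K ≠ 0) (h : K ∣ t + 1) :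
    t % K + 1 = K ∧ (t + 1) % K = 0 := by
  have h1 : (t % K + 1) % K = 0 := by rw [Nat.mod_add_mod]; exact Nat.mod_eq_zero_of_dvd h
  have h2 : t % K < K := Nat.mod_lt _ (Nat.pos_of_ne_zero hK)
  refine ⟨?_, Nat.mod_eq_zero_of_dvd h⟩
  by_contra h3
  rw [Nat.mod_eq_of_lt (by omega)] at h1
  omega

theorem mod_add_one_of_not_dvd {K t : ℕ} (hK : K ≠ 0) (h : ¬ K ∣ t + 1) :
    t % K + 1 < K ∧ (t + 1) % K = t % K + 1 := by
  have h2 : t % K < K := Nat.mod_lt _ (Nat.pos_of_ne_zero hK)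
  have h1 : t % K + 1 < K := by
    by_contra h3
    refine h (Nat.dvd_of_mod_eq_zero ?_)
    rw [← Nat.mod_add_mod, show t % K + 1 = K by omega, Nat.mod_self]
  exact ⟨h1, by rw [← Nat.mod_add_mod, Nat.mod_eq_of_lt h1]⟩

theorem nextFlags_of_dvd {N R K t : ℕ} {acc : Fin N → Bool} {a : Fin N → Move R}
    (h : K ∣ t + 1) (n : Fin N) : nextFlags K t acc a n = false := if_pos h

theorem nextFlags_of_success {N R K t : ℕ} {acc : Fin N → Bool} {a : Fin N → Move R} {n : Fin N}
    (h : ¬ K ∣ t + 1) (hs : feedback a n = Feedback.success) : nextFlags K t acc a n = true :=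
  (if_neg h).trans (if_pos hs)

theorem nextFlags_of_not_success {N R K t : ℕ} {acc : Fin N → Bool} {a : Fin N → Move R}
    {n : Fin N} (h : ¬ K ∣ t + 1) (hs : feedback a n ≠ Feedback.success) :
    nextFlags K t acc a n = acc n :=
  (if_neg h).trans (if_neg hs)

/-- The discounted value at time `t` of one success as early as the quota allows in every episode;
`flag` tells whether the current episode's success has been had. -/
def earlyValue (K : ℕ) (δ : ℝ) (t : ℕ) (flag : Bool) : ℝ :=
  (if flag then 0 else 1) + δ ^ (K - t % K) * (1 / (1 - δ ^ K))

/-- The discounted value at time `t` of one success in the last time-step of every episode, the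
current one excepted if `flag` is up. -/
def lateValue (K : ℕ) (δ : ℝ) (t : ℕ) (flag : Bool) : ℝ :=
  (if flag then 0 else δ ^ (K - 1 - t % K)) + δ ^ (K - t % K) * (δ ^ (K - 1) * (1 / (1 - δ ^ K)))

section Quota

variable {K : ℕ} [NeZero K] {δ : ℝ} (hδ0 : 0 < δ) (hδ1 : δ < 1)

include hδ0 hδ1

theorem one_sub_pow_pos : 0 < 1 - δ ^ K :=
  sub_pos.2 (pow_lt_one₀ hδ0.le hδ1 (NeZero.ne K))

theorem episodes_value_nonneg : 0 ≤ 1 / (1 - δ ^ K) := (one_div_pos.2 (one_sub_pow_pos hδ0 hδ1)).le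

/-- The fixed-point equation for one unit at the start of every episode; it joins the potentials
across the end of an episode. -/
theorem one_add_episodes_value : 1 + δ ^ K * (1 / (1 - δ ^ K)) = 1 / (1 - δ ^ K) := by
  have h := (one_sub_pow_pos (K := K) hδ0 hδ1).ne'
  field_simp
  ring

theorem earlyValue_nonneg (t : ℕ) (flag : Bool) : 0 ≤ earlyValue K δ t flag := by
  have := episodes_value_nonneg (K := K) hδ0 hδ1
  unfold earlyValue
  split_ifs <;> positivity

theorem earlyValue_le (t : ℕ) (flag : Bool) :
    earlyValue K δ t flag ≤ 1 + 1 / (1 - δ ^ K) := by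
  have h0 := episodes_value_nonneg (K := K) hδ0 hδ1
  have h1 : δ ^ (K - t % K) * (1 / (1 - δ ^ K)) ≤ 1 / (1 - δ ^ K) :=
    mul_le_of_le_one_left h0 (pow_le_one₀ hδ0.le hδ1.le)
  unfold earlyValue
  split_ifs <;> linarith

theorem lateValue_le_earlyValue (t : ℕ) (flag : Bool) :
    lateValue K δ t flag ≤ earlyValue K δ t flag := by
  have h0 := episodes_value_nonneg (K := K) hδ0 hδ1
  have h1 : δ ^ (K - 1) * (1 / (1 - δ ^ K)) ≤ 1 / (1 - δ ^ K) :=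
    mul_le_of_le_one_left h0 (pow_le_one₀ hδ0.le hδ1.le)
  unfold lateValue earlyValue
  refine add_le_add ?_ (mul_le_mul_of_nonneg_left h1 (by positivity))
  split_ifs
  · exact le_rfl
  · exact pow_le_one₀ hδ0.le hδ1.le

/-- Worst case: the success of the current episode is dropped and the next episode is a full `K`
steps away. -/
theorem le_lateValue (t : ℕ) (flag : Bool) :
    δ ^ K * (δ ^ (K - 1) * (1 / (1 - δ ^ K))) ≤ lateValue K δ t flag := by
  have h0 := episodes_value_nonneg (K := K) hδ0 hδ1
  have h1 : δ ^ K ≤ δ ^ (K - t % K) := pow_le_pow_of_le_one hδ0.le hδ1.le (Nat.sub_le _ _)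
  have h2 : (0 : ℝ) ≤ if flag then 0 else δ ^ (K - 1 - t % K) := by split_ifs <;> positivity
  unfold lateValue
  linarith [mul_le_mul_of_nonneg_right h1 (mul_nonneg (pow_nonneg hδ0.le (K - 1)) h0)]

/-- The hypotheses abstract the quota: a positive payoff requires a lowered flag and, within an
episode, raises it. The unit gained is then exactly the unit that the potential loses. -/
theorem earlyValue_step {t : ℕ} {flag flag' : Bool} {c : ℝ}
    (hdvd : K ∣ t + 1 → flag' = false) (hc : c ≤ 1)
    (hflag : flag = true → c ≤ 0 ∧ (¬ K ∣ t + 1 → flag' = true))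
    (hc' : ¬ K ∣ t + 1 → flag' = false → c ≤ 0) :
    c + δ * earlyValue K δ (t + 1) flag' ≤ earlyValue K δ t flag := by
  have hv := one_add_episodes_value (K := K) hδ0 hδ1
  unfold earlyValue
  by_cases hd : K ∣ t + 1
  · obtain ⟨h1, h2⟩ := mod_add_one_of_dvd (NeZero.ne K) hd
    rw [hdvd hd, h2, show K - t % K = 1 by omega, Nat.sub_zero, pow_one]
    simp only [Bool.false_eq_true, if_false, hv]
    split_ifs with hf
    · linarith [(hflag hf).1]
    · linarith
  · obtain ⟨h1, h2⟩ := mod_add_one_of_not_dvd (NeZero.ne K) hd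
    rw [h2, show K - t % K = K - (t % K + 1) + 1 by omega, pow_succ]
    have : c + δ * (if flag' then 0 else 1) ≤ if flag then 0 else 1 := by
      by_cases hf : flag = true
      · simp [(hflag hf).2 hd, hf, (hflag hf).1]
      · cases flag'
        · simpa [hf] using by linarith [hc' hd rfl]
        · simpa [hf] using hc
    linarith

/-- The part of `lateValue` due to future episodes survives one step. At the end of an episode it
becomes the whole value, since the flag is lowered; before that, the nonnegative term of the current
episode is discarded. -/
theorem tail_le_lateValue_step (t : ℕ) {flag' : Bool} (hdvd : K ∣ t + 1 → flag' = false) :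
    δ ^ (K - t % K) * (δ ^ (K - 1) * (1 / (1 - δ ^ K))) ≤ δ * lateValue K δ (t + 1) flag' := by
  have hv := one_add_episodes_value (K := K) hδ0 hδ1
  unfold lateValue
  by_cases hd : K ∣ t + 1
  · obtain ⟨h1, h2⟩ := mod_add_one_of_dvd (NeZero.ne K) hd
    rw [hdvd hd, h2, show K - t % K = 1 by omega, Nat.sub_zero, Nat.sub_zero, pow_one]
    simp only [Bool.false_eq_true, if_false]
    nth_rw 1 [← hv]
    exact le_of_eq (by ring)
  · obtain ⟨h1, h2⟩ := mod_add_one_of_not_dvd (NeZero.ne K) hd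
    rw [h2, show K - t % K = K - (t % K + 1) + 1 by omega, pow_succ]
    have : (0 : ℝ) ≤ δ * if flag' then 0 else δ ^ (K - 1 - (t % K + 1)) := by
      split_ifs <;> positivity
    linarith

/-- In any step the payoff is at worst `ζ`, and at worst the current episode's success, worth at
most `1`, is lost. -/
theorem lateValue_step_of_le {ζ c : ℝ} {t : ℕ} {flag flag' : Bool}
    (hdvd : K ∣ t + 1 → flag' = false) (hc : ζ ≤ c) :
    lateValue K δ t flag ≤ c + δ * lateValue K δ (t + 1) flag' + (1 - ζ) := by
  have h := tail_le_lateValue_step hδ0 hδ1 t hdvd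
  have h1 : (if flag then 0 else δ ^ (K - 1 - t % K)) ≤ (1 : ℝ) := by
    split_ifs
    · exact zero_le_one
    · exact pow_le_one₀ hδ0.le hδ1.le
  rw [lateValue]
  linarith

/-- There is no loss if a success still due is either had now, no later than credited, or remains
due while the episode goes on. -/
theorem lateValue_step_of_settled {c : ℝ} {t : ℕ} {flag flag' : Bool}
    (hdvd : K ∣ t + 1 → flag' = false) (hc : 0 ≤ c)
    (h : flag = false → 1 ≤ c ∨ (¬ K ∣ t + 1 ∧ flag' = false)) :
    lateValue K δ t flag ≤ c + δ * lateValue K δ (t + 1) flag' := by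
  have ht := tail_le_lateValue_step hδ0 hδ1 t hdvd
  cases flag with
  | true => simp only [lateValue, if_true] at ht ⊢; linarith
  | false =>
    rcases h rfl with h | ⟨hd, rfl⟩
    · have h1 : δ ^ (K - 1 - t % K) ≤ 1 := pow_le_one₀ hδ0.le hδ1.le
      simp only [lateValue, Bool.false_eq_true, if_false] at ht ⊢
      linarith
    · obtain ⟨h1, h2⟩ := mod_add_one_of_not_dvd (NeZero.ne K) hd
      simp only [lateValue, Bool.false_eq_true, if_false]
      rw [h2, show K - t % K = K - (t % K + 1) + 1 by omega,
        show K - 1 - t % K = K - 1 - (t % K + 1) + 1 by omega, pow_succ, pow_succ]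
      linarith

/-- Because of the quota no strategy earns more than one success per episode. -/
theorem expectedPayoff_le {N R : ℕ} {ζ : ℝ} (hζ : ζ < 0) (s : ℕ) (acc : Fin N → Bool)
    (σ : Fin N → Strategy R K) (n : Fin N) :
    expectedPayoff ζ δ s acc σ n ≤ 1 + 1 / (1 - δ ^ K) := by
  set V := 1 + 1 / (1 - δ ^ K) with hV
  have hW : ∀ t flag, |-earlyValue K δ t flag| ≤ V := fun t flag => by
    rw [abs_neg, abs_of_nonneg (earlyValue_nonneg hδ0 hδ1 t flag)]
    exact earlyValue_le hδ0 hδ1 t flag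
  have hc : ∀ x : Stage σ, |-stagePayoff ζ x.moves n| ≤ 1 - ζ := fun x => by
    rw [abs_neg]; exact abs_stagePayoff_le hζ _ _
  -- The principle gives lower bounds, so rewards and potential are negated.
  have key := expect_le_integral_discounted σ s acc hc hδ0.le hδ1
    (W := fun t _ a => -earlyValue K δ t (a n)) (B := V) (fun t m a => hW t (a n)) ?_
  · simp only [expect_const, mul_neg, tsum_neg, integral_neg] at key
    exact (neg_le_neg_iff.1 key).trans (earlyValue_le hδ0 hδ1 _ _)
  · intro t m a
    simp only [expect_const]
    have hb : ∀ x : Stage σ, |-stagePayoff ζ x.moves n +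
        δ * -earlyValue K δ (t + 1) (nextFlags K t x.accessed x.moves n)| ≤ (1 - ζ) + δ * V := by
      intro x
      refine (abs_add_le _ _).trans (add_le_add (hc x) ?_)
      rw [abs_mul, abs_of_pos hδ0]
      exact mul_le_mul_of_nonneg_left (hW _ _) hδ0.le
    refine le_expect _ hb fun x hx => ?_
    obtain ⟨-, rfl, hx⟩ := (mem_support_chooseMoves σ t m a x).1 hx
    suffices stagePayoff ζ x.moves n + δ * earlyValue K δ (t + 1)
        (nextFlags K t x.accessed x.moves n) ≤ earlyValue K δ t (x.accessed n) by linarith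
    have hacc : x.accessed n = true → ∀ r, x.moves n ≠ Move.access r := by
      intro hn r hr
      obtain ⟨b, -, hb⟩ := hx n
      rw [hr, hn] at hb
      cases b <;> simp [enforceQuota] at hb
    have hns : x.accessed n = true → feedback x.moves n ≠ Feedback.success := fun hn hs => by
      obtain ⟨r, hr, -⟩ := feedback_eq_success_iff.1 hs
      exact hacc hn r hr
    refine earlyValue_step hδ0 hδ1 (fun h => nextFlags_of_dvd h n) ?_ ?_ ?_
    · by_cases h : feedback x.moves n = Feedback.success
      · exact (stagePayoff_of_success h).le
      · exact (stagePayoff_nonpos hζ h).trans zero_le_one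
    · exact fun hn => ⟨stagePayoff_nonpos hζ (hns hn), fun hd =>
        (nextFlags_of_not_success hd (hns hn)).trans hn⟩
    · intro hd hf
      refine stagePayoff_nonpos hζ fun hs => ?_
      rw [nextFlags_of_success hd hs] at hf
      exact Bool.noConfusion hf

end Quota

/-! ### Absorption of finite Markov chains -/

section Chain

variable {S : Type*} (P : S → PMF S) (G : Set S)

/-- The states from which the chain `P` can be in `G` after at most `d` steps. -/
def reachable : ℕ → Set S
  | 0 => G
  | d + 1 => reachable d ∪ {x | ∃ y ∈ reachable d, y ∈ (P x).support}

theorem reachable_mono {d e : ℕ} (h : d ≤ e) : reachable P G d ⊆ reachable P G e := by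
  induction h with
  | refl => exact subset_rfl
  | step _ ih => exact ih.trans Set.subset_union_left

variable [Finite S]

/-- Induction on `d`, with `q` the least positive transition probability and `ind` the indicator of
not being within `d` steps of `G`. The new function is `(1 + 1 / q) * h + 1 / q * ind`. At a newly
covered state `ind` falls by at least `q` on average, a gain of `1`. At a state already covered
`ind` may rise by `1`, but the drop of `1 + 1 / q` from the first term pays for it. Elsewhere
outside `G`, `ind` is already maximal. -/
theorem exists_drift (d : ℕ) : ∃ (h : S → ℝ) (H : ℝ), (∀ x, 0 ≤ h x) ∧ (∀ x, h x ≤ H) ∧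
    (∀ x ∈ G, h x = 0) ∧ (∀ x ∉ G, expect (P x) h ≤ h x) ∧
    ∀ x ∈ reachable P G d, x ∉ G → expect (P x) h ≤ h x - 1 := by
  classical
  induction d with
  | zero => exact ⟨fun _ => 0, 0, fun _ => le_rfl, fun _ => le_rfl, fun _ _ => rfl,
      fun x _ => (expect_const _ _).le, fun x hx hx' => absurd hx hx'⟩
  | succ d ih =>
    obtain ⟨h, H, h0, hH, hG, hsup, hd⟩ := ih
    have hb : ∀ x, |h x| ≤ H := fun x => (abs_of_nonneg (h0 x)).trans_le (hH x)
    obtain ⟨q, hq0, hq⟩ : ∃ q : ℝ, 0 < q ∧ ∀ x, ∀ y ∈ (P x).support, q ≤ (P x y).toReal := by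
      rcases isEmpty_or_nonempty S with hS | hS
      · exact ⟨1, one_pos, fun x => (hS.false x).elim⟩
      -- Zero probabilities are replaced by `1`, so that the minimum over the finite set of pairs is
      -- positive.
      · obtain ⟨z, hz⟩ := Finite.exists_min fun z : S × S =>
          if (P z.1 z.2).toReal = 0 then (1 : ℝ) else (P z.1 z.2).toReal
        refine ⟨_, ?_, fun x y hxy => (hz (x, y)).trans ?_⟩
        · split_ifs with h
          · exact one_pos
          · exact lt_of_le_of_ne ENNReal.toReal_nonneg (Ne.symm h)
        · exact (if_neg (ENNReal.toReal_ne_zero.2 ⟨hxy, (P x).apply_ne_top y⟩)).le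
    set ind : S → ℝ := fun x => if x ∈ reachable P G d then 0 else 1 with hind
    have hi0 : ∀ x, 0 ≤ ind x := fun x => by simp only [hind]; split_ifs <;> norm_num
    have hi1 : ∀ x, ind x ≤ 1 := fun x => by simp only [hind]; split_ifs <;> norm_num
    have hib : ∀ x, |ind x| ≤ 1 := fun x => (abs_of_nonneg (hi0 x)).trans_le (hi1 x)
    have hE : ∀ x, expect (P x) (fun y => (1 + 1 / q) * h y + 1 / q * ind y) =
        (1 + 1 / q) * expect (P x) h + 1 / q * expect (P x) ind :=
      fun x => expect_mul_add_mul _ hb hib _ _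
    have hq1 : 0 < 1 / q := one_div_pos.2 hq0
    have hEi : ∀ x, expect (P x) ind ≤ 1 := fun x => expect_le _ hib fun a _ => hi1 a
    have hnew : ∀ x ∈ reachable P G (d + 1), x ∉ G →
        (1 + 1 / q) * expect (P x) h + 1 / q * expect (P x) ind ≤
          (1 + 1 / q) * h x + 1 / q * ind x - 1 := by
      intro x hx hxG
      by_cases hxd : x ∈ reachable P G d
      · have h1 : ind x = 0 := if_pos hxd
        rw [h1]
        nlinarith [hd x hxd hxG, hEi x]
      · obtain ⟨y, hy, hxy⟩ := hx.resolve_left hxd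
        have h1 : ind x = 1 := if_neg hxd
        have h2 : expect (P x) ind ≤ 1 - q := by
          have hpt : expect (P x) (fun z => if z = y then 1 else 0) = (P x y).toReal := by
            rw [expect, tsum_eq_single y]
            · simp
            · intro b hb; simp [hb]
          have hle : expect (P x) ind ≤
              expect (P x) fun z => 1 * 1 + (-1) * if z = y then 1 else 0 := by
            refine expect_mono _ hib (C := 2) (fun a => ?_) fun a _ => ?_
            · split_ifs <;> norm_num
            · split_ifs with ha
              · simp [hind, ha, hy]
              · simpa using hi1 a
          rw [expect_mul_add_mul (P x) (f := fun _ => 1) (g := fun z => if z = y then 1 else 0)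
            (B := 1) (C := 1) (by simp) (fun a => by split_ifs <;> simp), expect_const,
            hpt] at hle
          linarith [hq x y hxy]
        have h3 : 1 / q * (1 - q) = 1 / q - 1 := by field_simp
        rw [h1]
        nlinarith [hsup x hxG, mul_le_mul_of_nonneg_left h2 hq1.le]
    refine ⟨fun x => (1 + 1 / q) * h x + 1 / q * ind x, (1 + 1 / q) * H + 1 / q * 1,
      fun x => ?_, fun x => ?_, fun x hx => ?_, fun x hx => ?_, fun x hx hxG => ?_⟩
    · have := h0 x; have := hi0 x; positivity
    · exact add_le_add (mul_le_mul_of_nonneg_left (hH x) (by positivity))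
        (mul_le_mul_of_nonneg_left (hi1 x) hq1.le)
    · have h1 : ind x = 0 := if_pos (reachable_mono P G (Nat.zero_le d) hx)
      simp [hG x hx, h1]
    · rw [hE]
      by_cases hxd : x ∈ reachable P G (d + 1)
      · linarith [hnew x hxd hx]
      · have h1 : ind x = 1 := if_neg fun hx' => hxd (reachable_mono P G d.le_succ hx')
        simp only [h1]
        nlinarith [hsup x hx, hEi x]
    · rw [hE]; exact hnew x hx hxG

/-- If `G` can be reached from every state of a finite Markov chain, then there is a bounded
nonnegative function, zero on `G`, that decreases by at least `1` on average in each step outside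
of `G`. -/
theorem exists_lyapunov (hreach : ∀ x, ∃ y ∈ G,
    Relation.ReflTransGen (fun x y => y ∈ (P x).support) x y) :
    ∃ (h : S → ℝ) (H : ℝ), (∀ x, 0 ≤ h x) ∧ (∀ x, h x ≤ H) ∧ (∀ x ∈ G, h x = 0) ∧
      ∀ x ∉ G, expect (P x) h ≤ h x - 1 := by
  have hd : ∀ x, ∃ d, x ∈ reachable P G d := by
    intro x
    obtain ⟨y, hy, hxy⟩ := hreach x
    induction hxy using Relation.ReflTransGen.head_induction_on with
    | refl => exact ⟨0, hy⟩
    | head hab _ ih =>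
      obtain ⟨d, hd⟩ := ih
      exact ⟨d + 1, Or.inr ⟨_, hd, hab⟩⟩
  choose d hd using hd
  obtain ⟨D, hD⟩ := (Set.finite_range d).bddAbove
  obtain ⟨h, H, h0, hH, hG, -, hdr⟩ := exists_drift P G D
  exact ⟨h, H, h0, hH, hG, fun x hx =>
    hdr x (reachable_mono P G (hD ⟨x, rfl⟩) (hd x)) hx⟩

end Chain

/-! ### The Markov chain of the courteous tables and flags -/

section Column

variable {N R : ℕ} (acc : Fin N → Bool) (c : Fin N → Option (Fin R))

/-- Given the flags `acc` and the column `c` of the tables, resource `r` is accessed. -/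
def Occupied (r : Fin R) : Prop := ∃ j, acc j = false ∧ c j = some r

/-- Given the flags `acc` and the column `c` of the tables, agent `n` has a successful access. -/
def Succeeds (n : Fin N) : Prop :=
  ∃ r, (acc n = false ∧ c n = some r) ∧ ∀ j, j ≠ n → ¬ (acc j = false ∧ c j = some r)

/-- A courteous agent `n` may replace his entry `c n` by `v`. -/
def Allowed (n : Fin N) (v : Option (Fin R)) : Prop :=
  (∃ r, c n = some r ∧ (v = some r ∨
    v = none ∧ acc n = false ∧ ∃ j, j ≠ n ∧ acc j = false ∧ c j = some r)) ∨
  (c n = none ∧ ((v = none ∧ ∃ r, Occupied acc c r) ∨ ∃ r, v = some r ∧ ¬ Occupied acc c r))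

open Classical in
/-- The flags after a time-step in context `k`. -/
def stepFlags (K k : ℕ) (n : Fin N) : Bool :=
  if K ∣ k + 1 then false else if Succeeds acc c n then true else acc n

variable {acc c}

theorem Allowed.of_some {n : Fin N} {r : Fin R} {v : Option (Fin R)} (h : Allowed acc c n v)
    (hr : c n = some r) : v = some r ∨
      v = none ∧ acc n = false ∧ ∃ j, j ≠ n ∧ acc j = false ∧ c j = some r := by
  rcases h with ⟨r', hr', h⟩ | ⟨h, -⟩
  · rw [hr, Option.some_inj] at hr'
    rwa [hr']
  · rw [hr] at h; cases h

theorem Allowed.of_none {n : Fin N} {v : Option (Fin R)} (h : Allowed acc c n v)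
    (hr : c n = none) : (v = none ∧ ∃ r, Occupied acc c r) ∨
      ∃ r, v = some r ∧ ¬ Occupied acc c r := by
  rcases h with ⟨r', hr', h⟩ | ⟨-, h⟩
  · rw [hr] at hr'; cases hr'
  · exact h

theorem exists_allowed [NeZero R] (acc : Fin N → Bool) (c : Fin N → Option (Fin R)) (n : Fin N) :
    ∃ v, Allowed acc c n v := by
  rcases hc : c n with _ | r
  · by_cases h : Occupied acc c (0 : Fin R)
    · exact ⟨none, Or.inr ⟨hc, Or.inl ⟨rfl, 0, h⟩⟩⟩
    · exact ⟨some 0, Or.inr ⟨hc, Or.inr ⟨0, rfl, h⟩⟩⟩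
  · exact ⟨some r, Or.inl ⟨r, hc, Or.inl rfl⟩⟩

end Column

section Chain

variable {N R K : ℕ} [NeZero R] [NeZero K] (p : ℝ) (hp0 : 0 < p) (hp1 : p < 1)

/-- The law of the new table of a courteous agent. -/
def updateLaw (g : Table R K) (k : Fin K) (b : Move R) (f : Feedback) : PMF (Table R K) :=
  (courteous R K p hp0.le hp1.le).update g k b f

/-- The law of the executed moves of courteous agents in context `k`. -/
def moveLaw (k : Fin K) (m : Fin N → Table R K) (acc : Fin N → Bool) : PMF (Fin N → Move R) :=
  independent fun i =>
    ((courteous R K p hp0.le hp1.le).act (m i) k (acc i)).map (enforceQuota (acc i))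

/-- The law of the new tables of courteous agents after the moves `a` in context `k`. -/
def tableLaw (k : Fin K) (m : Fin N → Table R K) (a : Fin N → Move R) :
    PMF (Fin N → Table R K) :=
  independent fun i => updateLaw p hp0 hp1 (m i) k (a i) (feedback a i)

/-- The context, the tables and the flags of courteous agents form a Markov chain. -/
def chain (x : Fin K × (Fin N → Table R K) × (Fin N → Bool)) :
    PMF (Fin K × (Fin N → Table R K) × (Fin N → Bool)) :=
  (moveLaw p hp0 hp1 x.1 x.2.1 x.2.2).bind fun a =>
    (tableLaw p hp0 hp1 x.1 x.2.1 a).map fun m => (x.1 + 1, m, nextFlags K x.1 x.2.2 a)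

/-- A courteous agent with entry `v` and flag `b` may execute the move `a`. -/
def MoveAllowed (v : Option (Fin R)) (b : Bool) (a : Move R) : Prop :=
  (∃ r, v = some r ∧ a = if b then Move.yield else Move.access r) ∨
    (v = none ∧ ∃ r, a = Move.monitor r)

theorem mem_support_moveLaw {k : Fin K} {m : Fin N → Table R K} {acc : Fin N → Bool}
    {a : Fin N → Move R} : a ∈ (moveLaw p hp0 hp1 k m acc).support ↔
      ∀ i, MoveAllowed (m i k) (acc i) (a i) := by
  rw [moveLaw, mem_support_independent]
  refine forall_congr' fun i => ?_
  rw [PMF.mem_support_map_iff]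
  simp only [courteous, courteousFrom, MoveAllowed]
  rcases hm : m i k with _ | r
  · simp only [PMF.mem_support_map_iff, PMF.support_uniformOfFintype]
    constructor
    · rintro ⟨b, ⟨r, -, rfl⟩, h⟩
      exact Or.inr ⟨trivial, r, h.symm⟩
    · rintro (⟨r, h, -⟩ | ⟨-, r, h⟩)
      · cases h
      · exact ⟨_, ⟨r, trivial, rfl⟩, h.symm⟩
  · have hact : ∀ b, b ∈ (PMF.pure (if acc i then Move.yield else Move.access r)).support ↔
        b = if acc i then Move.yield else Move.access r := fun b => PMF.mem_support_pure_iff _ _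
    simp only [hact, exists_eq_left]
    constructor
    · intro h
      refine Or.inl ⟨r, rfl, h.symm.trans ?_⟩
      cases acc i <;> rfl
    · rintro (⟨r', hr', h⟩ | ⟨h, -⟩)
      · cases hr'
        rw [h]
        cases acc i <;> rfl
      · cases h

variable {m : Fin N → Table R K} {k : Fin K} {acc : Fin N → Bool} {a : Fin N → Move R}

/-- Only the monitored resources are random: who accesses what, and hence every success and the next
flags, is determined by the column and the flags. -/
theorem access_iff (ha : ∀ i, MoveAllowed (m i k) (acc i) (a i)) (j : Fin N) (r : Fin R) :
    a j = Move.access r ↔ acc j = false ∧ m j k = some r := by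
  rcases ha j with ⟨r', hr', h⟩ | ⟨hn, r', h⟩
  · rw [h, hr']
    cases acc j <;> simp
  · simp [h, hn]

theorem feedback_success_iff (ha : ∀ i, MoveAllowed (m i k) (acc i) (a i)) (n : Fin N) :
    feedback a n = Feedback.success ↔ Succeeds acc (fun i => m i k) n := by
  simp only [feedback_eq_success_iff, Succeeds, ne_eq, access_iff ha]

theorem nextFlags_eq (ha : ∀ i, MoveAllowed (m i k) (acc i) (a i)) (t : ℕ) :
    nextFlags K t acc a = stepFlags acc (fun i => m i k) K t := by
  funext n
  by_cases h : Succeeds acc (fun i => m i k) n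
  · simp only [nextFlags, stepFlags, if_pos h, if_pos ((feedback_success_iff ha n).2 h)]
  · simp only [nextFlags, stepFlags, if_neg h, if_neg fun h' => h ((feedback_success_iff ha n).1 h')]

theorem coin_support (hp0 : 0 < p) (hp1 : p < 1) (b : Bool) :
    b ∈ (coin p hp0.le hp1.le).support := by
  rw [coin, PMF.mem_support_ofFintype_iff]
  cases b <;> simp [hp0, hp1]

theorem mem_support_update (ha : ∀ i, MoveAllowed (m i k) (acc i) (a i)) (n : Fin N)
    (g : Table R K) :
    g ∈ (updateLaw p hp0 hp1 (m n) k (a n) (feedback a n)).support ↔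
      ∃ v, g = Function.update (m n) k v ∧
        ((∃ r, m n k = some r ∧ (v = some r ∨ v = none ∧ acc n = false ∧
          ∃ j, j ≠ n ∧ acc j = false ∧ m j k = some r)) ∨
        ∃ r, a n = Move.monitor r ∧ ((v = none ∧ m n k = none ∧ Occupied acc (fun i => m i k) r) ∨
          (v = some r ∧ ¬ Occupied acc (fun i => m i k) r))) := by
  have hself : ∀ v, m n k = v → Function.update (m n) k v = m n := fun v hv => by
    rw [← hv, Function.update_eq_self]
  rcases ha n with ⟨r, hr, h⟩ | ⟨hn, r, h⟩
  · cases hacc : acc n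
    · have h' : a n = Move.access r := by simpa [hacc] using h
      by_cases hcol : ∃ j, j ≠ n ∧ a j = Move.access r
      · have hf : feedback a n = Feedback.collision := by simp [feedback, h', hcol]
        have hc : ∃ j, j ≠ n ∧ acc j = false ∧ m j k = some r := by
          simpa only [access_iff ha] using hcol
        have hu : updateLaw p hp0 hp1 (m n) k (a n) (feedback a n) =
            (coin p hp0.le hp1.le).map fun b => if b then Function.update (m n) k none else m n := by
          rw [h', hf]; rfl
        rw [hu, PMF.mem_support_map_iff]
        simp only [hr, h', Option.some_inj, reduceCtorEq, false_and, exists_const, or_false,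
          exists_eq_left', coin_support p hp0 hp1, true_and, Bool.exists_bool, if_true,
          Bool.false_eq_true, if_false, hc, and_true, and_or_left, exists_or, exists_eq_right,
          hself _ hr]
        rw [eq_comm, eq_comm (b := g)]
      · have hf : feedback a n = Feedback.success := by simp [feedback, h', hcol]
        have hc : ¬ ∃ j, j ≠ n ∧ acc j = false ∧ m j k = some r := by
          simpa only [access_iff ha] using hcol
        have hu : updateLaw p hp0 hp1 (m n) k (a n) (feedback a n) = PMF.pure (m n) := by
          rw [h', hf]; rfl
        rw [hu, PMF.mem_support_pure_iff]
        simp [h', hr, hc, hself _ hr]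
    · have h' : a n = Move.yield := by simpa [hacc] using h
      have hu : updateLaw p hp0 hp1 (m n) k (a n) (feedback a n) = PMF.pure (m n) := by
        rw [h']; rfl
      rw [hu, PMF.mem_support_pure_iff]
      simp [h', hr, hself _ hr]
  · by_cases hocc : Occupied acc (fun i => m i k) r
    · have hf : feedback a n = Feedback.occupied := by
        simpa [feedback, h, access_iff ha, Occupied] using hocc
      have hu : updateLaw p hp0 hp1 (m n) k (a n) (feedback a n) = PMF.pure (m n) := by
        rw [h, hf]; rfl
      rw [hu, PMF.mem_support_pure_iff]
      simp [h, hn, hself _ hn, hocc]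
    · have hf : feedback a n = Feedback.free := by
        simpa [feedback, h, access_iff ha, Occupied] using hocc
      have hu : updateLaw p hp0 hp1 (m n) k (a n) (feedback a n) =
          PMF.pure (Function.update (m n) k (some r)) := by
        rw [h, hf]; rfl
      rw [hu, PMF.mem_support_pure_iff]
      simp [h, hn, hocc]

/-- Agents randomise independently and the coin can show either side, so every combination of
individually allowed entries occurs with positive probability. Reachability thus becomes
combinatorial. -/
theorem mem_support_chain {x y : Fin K × (Fin N → Table R K) × (Fin N → Bool)} :
    y ∈ (chain p hp0 hp1 x).support ↔ y.1 = x.1 + 1 ∧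
      y.2.2 = stepFlags x.2.2 (fun i => x.2.1 i x.1) K x.1 ∧
      ∃ v : Fin N → Option (Fin R), (∀ n, Allowed x.2.2 (fun i => x.2.1 i x.1) n (v n)) ∧
        y.2.1 = fun n => Function.update (x.2.1 n) x.1 (v n) := by
  obtain ⟨k, m, acc⟩ := x
  obtain ⟨k', m', acc'⟩ := y
  simp only [chain, PMF.mem_support_bind_iff, PMF.mem_support_map_iff, mem_support_moveLaw,
    tableLaw, mem_support_independent, Prod.mk.injEq]
  constructor
  · rintro ⟨a, ha, m', hm', rfl, rfl, rfl⟩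
    refine ⟨rfl, nextFlags_eq ha _, ?_⟩
    choose v hv hv' using fun n => (mem_support_update p hp0 hp1 ha n _).1 (hm' n)
    refine ⟨v, fun n => ?_, funext hv⟩
    rcases hv' n with h | ⟨r, hr, h⟩
    · exact Or.inl h
    · refine Or.inr ⟨?_, ?_⟩
      · rcases ha n with ⟨r', -, h'⟩ | ⟨h', -⟩
        · rw [hr] at h'; cases hn : acc n <;> simp [hn] at h'
        · exact h'
      · rcases h with ⟨h1, -, h2⟩ | ⟨h1, h2⟩
        · exact Or.inl ⟨h1, r, h2⟩
        · exact Or.inr ⟨r, h1, h2⟩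
  · rintro ⟨rfl, rfl, v, hv, rfl⟩
    -- Each agent's move is chosen to explain his new entry: a monitoring agent looks at an occupied
    -- resource to stay empty, or at the free resource that he takes.
    have hex : ∀ n, ∃ b, MoveAllowed (m n k) (acc n) b ∧
        ((∃ r, m n k = some r ∧ (v n = some r ∨ v n = none ∧ acc n = false ∧
          ∃ j, j ≠ n ∧ acc j = false ∧ m j k = some r)) ∨
        ∃ r, b = Move.monitor r ∧
          ((v n = none ∧ m n k = none ∧ Occupied acc (fun i => m i k) r) ∨
          (v n = some r ∧ ¬ Occupied acc (fun i => m i k) r))) := by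
      intro n
      rcases hv n with ⟨r, hr, h⟩ | ⟨hn, ⟨h1, r, h2⟩ | ⟨r, h1, h2⟩⟩
      · exact ⟨_, Or.inl ⟨r, hr, rfl⟩, Or.inl ⟨r, hr, h⟩⟩
      · exact ⟨_, Or.inr ⟨hn, r, rfl⟩, Or.inr ⟨r, rfl, Or.inl ⟨h1, hn, h2⟩⟩⟩
      · exact ⟨_, Or.inr ⟨hn, r, rfl⟩, Or.inr ⟨r, rfl, Or.inr ⟨h1, h2⟩⟩⟩
    choose a ha ha' using hex
    exact ⟨a, ha, _, fun n => (mem_support_update p hp0 hp1 ha n _).2 ⟨v n, rfl, ha' n⟩,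
      rfl, rfl, nextFlags_eq ha _⟩

end Chain

/-! ### Settled tables -/

section Settled

variable {N R K : ℕ} {g g' : Fin N → Table R K}

/-- The first entry of agent `n` is the slot consisting of the context `j` and the resource `r`. -/
def Owns (g : Fin N → Table R K) (n : Fin N) (j : Fin K) (r : Fin R) : Prop :=
  g n j = some r ∧ ∀ i < j, g n i = none

/-- In context `j` no slot has two owners, and every slot has one if some agent still monitors. -/
def StableAt (g : Fin N → Table R K) (j : Fin K) : Prop :=
  (∀ n n' r, Owns g n j r → Owns g n' j r → n = n') ∧
    ∀ n, (∀ i < j, g n i = none) → g n j = none → ∀ r, ∃ m, Owns g m j r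

/-- Before context `k` the flag of every agent is up iff he has had an entry in this episode. -/
def Consistent (g : Fin N → Table R K) (k : ℕ) (acc : Fin N → Bool) : Prop :=
  ∀ n, acc n = false ↔ ∀ i : Fin K, (i : ℕ) < k → g n i = none

/-- The first entries before context `k` are the same in both families of tables. -/
def SameFirst (k : ℕ) (g g' : Fin N → Table R K) : Prop :=
  ∀ n (j : Fin K), (j : ℕ) < k → (∀ i < j, g n i = none) → g' n j = g n j

/-- Induction on `l`: agreement at a context is known only when all earlier entries are empty, which
is what the previous stage provides. -/
theorem SameFirst.none_iff {k : ℕ} (h : SameFirst k g g') (n : Fin N) {l : ℕ} (hl : l ≤ k) :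
    (∀ i : Fin K, (i : ℕ) < l → g' n i = none) ↔ ∀ i : Fin K, (i : ℕ) < l → g n i = none := by
  induction l with
  | zero => simp
  | succ l ih =>
    have ih := ih (by omega)
    have hsplit : ∀ f : Fin N → Table R K, (∀ i : Fin K, (i : ℕ) < l + 1 → f n i = none) ↔
        (∀ i : Fin K, (i : ℕ) < l → f n i = none) ∧ ∀ i : Fin K, (i : ℕ) = l → f n i = none :=
      fun f => ⟨fun h => ⟨fun i hi => h i (by omega), fun i hi => h i (by omega)⟩,
        fun h i hi => (Nat.lt_succ_iff_lt_or_eq.1 hi).elim (h.1 i) (h.2 i)⟩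
    rw [hsplit g, hsplit g', ih]
    refine and_congr_right fun hg => forall_congr' fun i => forall_congr' fun hi => ?_
    rw [h n i (by omega) fun j hj => hg j (by rw [Fin.lt_def] at hj; omega)]

theorem SameFirst.none_iff_lt {k : ℕ} (h : SameFirst k g g') (n : Fin N) {j : Fin K}
    (hj : (j : ℕ) ≤ k) : (∀ i < j, g' n i = none) ↔ ∀ i < j, g n i = none :=
  h.none_iff n hj

theorem SameFirst.owns_iff {k : ℕ} (h : SameFirst k g g') (n : Fin N) {j : Fin K}
    (hj : (j : ℕ) < k) (r : Fin R) : Owns g' n j r ↔ Owns g n j r := by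
  rw [Owns, Owns, h.none_iff_lt n hj.le, and_congr_left_iff]
  intro hg
  rw [h n j hj hg]

theorem SameFirst.stableAt {k : ℕ} (h : SameFirst k g g') {j : Fin K} (hj : (j : ℕ) < k)
    (hs : StableAt g j) : StableAt g' j := by
  simp only [StableAt, h.owns_iff _ hj, h.none_iff_lt _ hj.le]
  refine ⟨hs.1, fun n hn hn' => hs.2 n hn ?_⟩
  rwa [← h n j hj hn]

section Step

variable {k : Fin K} {acc : Fin N → Bool} (hs : StableAt g k) (hc : Consistent g k acc)

include hc in
theorem Consistent.owns_iff (n : Fin N) (r : Fin R) :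
    Owns g n k r ↔ acc n = false ∧ g n k = some r := by
  rw [hc n, Owns, and_comm]; rfl

include hs hc in
-- By consistency, those who access are exactly the owners. An owner has no rival to collide with,
-- and an agent with a lowered flag who monitors finds every resource owned.
theorem StableAt.allowed_eq {n : Fin N} (hn : acc n = false) {v : Option (Fin R)}
    (hv : Allowed acc (fun i => g i k) n v) : v = g n k := by
  rcases hg : g n k with _ | r
  · rcases hv.of_none hg with ⟨h, -⟩ | ⟨r, -, h⟩
    · exact h
    · obtain ⟨m, hm⟩ := hs.2 n ((hc n).1 hn) hg r
      exact absurd ⟨m, (hc.owns_iff m r).1 hm⟩ h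
  · rcases hv.of_some hg with h | ⟨-, -, j, hj, hj'⟩
    · exact h
    · exact absurd (hs.1 j n r ((hc.owns_iff j r).2 hj') ((hc.owns_iff n r).2 ⟨hn, hg⟩)) hj

include hs hc in
theorem StableAt.succeeds_iff (n : Fin N) :
    Succeeds acc (fun i => g i k) n ↔ acc n = false ∧ g n k ≠ none := by
  constructor
  · rintro ⟨r, ⟨h1, h2⟩, -⟩
    exact ⟨h1, fun h => Option.some_ne_none r (h2.symm.trans h)⟩
  · rintro ⟨h1, h2⟩
    obtain ⟨r, hr⟩ := Option.ne_none_iff_exists'.1 h2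
    exact ⟨r, ⟨h1, hr⟩, fun j hj hj' =>
      hj (hs.1 j n r ((hc.owns_iff j r).2 hj') ((hc.owns_iff n r).2 ⟨h1, hr⟩))⟩

open Classical in
include hs hc in
theorem StableAt.consistent_succ :
    Consistent g (k + 1) fun n => if Succeeds acc (fun i => g i k) n then true else acc n := by
  intro n
  have h1 : (if Succeeds acc (fun i => g i k) n then true else acc n) = false ↔
      acc n = false ∧ g n k = none := by
    split_ifs with h
    · simp [((hs.succeeds_iff hc n).1 h).2]
    · rw [hs.succeeds_iff hc n] at h
      tauto
  rw [h1, hc n]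
  constructor
  · rintro ⟨h1, h2⟩ i hi
    rcases Nat.lt_succ_iff_lt_or_eq.1 hi with hi | hi
    · exact h1 i hi
    · rwa [Fin.ext hi]
  · exact fun h => ⟨fun i hi => h i (by omega), h k (by omega)⟩

end Step

/-- Settled states: every agent has his own first slot, no agent who monitors before his first slot
finds a free resource, and the flags are as they should be. -/
def Settled (x : Fin K × (Fin N → Table R K) × (Fin N → Bool)) : Prop :=
  (∀ j, StableAt x.2.1 j) ∧ (∀ n, ∃ j, x.2.1 n j ≠ none) ∧ Consistent x.2.1 x.1 x.2.2

theorem val_add_one [NeZero K] (k : Fin K) : ((k + 1 : Fin K) : ℕ) = (k + 1) % K := by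
  rw [Fin.val_add, Fin.val_one', Nat.add_mod_mod]

theorem Settled.chain [NeZero R] [NeZero K] {p : ℝ} {hp0 : 0 < p} {hp1 : p < 1}
    {x y : Fin K × (Fin N → Table R K) × (Fin N → Bool)} (hx : Settled x)
    (hy : y ∈ (chain p hp0 hp1 x).support) : Settled y := by
  classical
  obtain ⟨k, g, acc⟩ := x
  obtain ⟨k', g', acc'⟩ := y
  obtain ⟨hs, he, hc⟩ := hx
  obtain ⟨rfl, rfl, v, hv, rfl⟩ := (mem_support_chain p hp0 hp1).1 hy
  dsimp only at hs he hc hv ⊢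
  -- If the entries before `k` are empty, the flag is down and the entry at `k` is frozen; otherwise
  -- entry `k` lies behind the first entry and does not count.
  have hsame : SameFirst K g fun n => Function.update (g n) k (v n) := by
    intro n j _ hj
    dsimp only
    by_cases hjk : j = k
    · subst hjk
      rw [Function.update_self, (hs j).allowed_eq hc ((hc n).2 hj) (hv n)]
    · rw [Function.update_of_ne hjk]
  have hnone : ∀ n {l : ℕ}, l ≤ K →
      ((∀ i : Fin K, (i : ℕ) < l → Function.update (g n) k (v n) i = none) ↔
        ∀ i : Fin K, (i : ℕ) < l → g n i = none) := fun n l hl => hsame.none_iff n hl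
  refine ⟨fun j => hsame.stableAt j.2 (hs j), fun n => ?_, fun n => ?_⟩
  · by_contra h
    push Not at h
    obtain ⟨j, hj⟩ := he n
    exact hj ((hnone n le_rfl).1 (fun i _ => h i) j j.2)
  · dsimp only
    rw [val_add_one]
    by_cases hd : K ∣ (k : ℕ) + 1
    · simp [stepFlags, hd, Nat.mod_eq_zero_of_dvd hd]
    · have hk : (k : ℕ) + 1 < K := by
        have := (mod_add_one_of_not_dvd (NeZero.ne K) hd).1
        rwa [Nat.mod_eq_of_lt k.2] at this
      rw [Nat.mod_eq_of_lt hk, hnone n hk.le, ← (hs k).consistent_succ hc n, stepFlags, if_neg hd]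

end Settled

/-! ### Settled states can be reached -/

section Reach

variable {N R K : ℕ}

open Classical in
/-- The flags before context `i` of an episode that is begun with the tables `g`. -/
def episodeFlags (g : Fin N → Table R K) : ℕ → Fin N → Bool
  | 0 => fun _ => false
  | i + 1 => if h : i < K then
      fun n => if Succeeds (episodeFlags g i) (fun m => g m ⟨i, h⟩) n then true
        else episodeFlags g i n
    else fun _ => false

theorem consistent_episodeFlags {g : Fin N → Table R K} {k : ℕ} (hk : k ≤ K)
    (hs : ∀ j : Fin K, (j : ℕ) < k → StableAt g j) : Consistent g k (episodeFlags g k) := by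
  induction k with
  | zero => intro n; simp [episodeFlags]
  | succ k ih =>
    have h := (hs ⟨k, hk⟩ (Nat.lt_succ_self k)).consistent_succ (k := ⟨k, hk⟩)
      (ih (by omega) fun j hj => hs j (by omega))
    rwa [episodeFlags, dif_pos (show k < K from hk)]

variable [NeZero R] [NeZero K] (p : ℝ) (hp0 : 0 < p) (hp1 : p < 1)

/-- The chain may go from `x` to `y` in finitely many steps. -/
def Leads (x y : Fin K × (Fin N → Table R K) × (Fin N → Bool)) : Prop :=
  Relation.ReflTransGen (fun x y => y ∈ (chain p hp0 hp1 x).support) x y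

/-- Each context reads and rewrites its own column only, so the columns met during an episode are
those of `g`, and the flags can be computed from `g` beforehand. -/
theorem leads_episode (g g' : Fin N → Table R K)
    (h : ∀ (j : Fin K) n, Allowed (episodeFlags g j) (fun i => g i j) n (g' n j)) :
    Leads p hp0 hp1 (0, g, fun _ => false) (0, g', fun _ => false) := by
  -- The tables before context `i`: the columns below `i` are already replaced.
  set mix : ℕ → Fin N → Table R K := fun i n j => if (j : ℕ) < i then g' n j else g n j with hmix
  have hupd : ∀ (k : Fin K) n, mix (k + 1) n = Function.update (mix k n) k (g' n k) := by
    intro k n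
    funext j
    by_cases hj : j = k
    · subst hj
      simp [hmix]
    · have : (j : ℕ) ≠ k := fun h => hj (Fin.ext h)
      rw [Function.update_of_ne hj]
      simp only [hmix]
      congr 1
      exact propext ⟨fun _ => by omega, fun _ => by omega⟩
  have hcol : ∀ k : Fin K, (fun i => mix k i k) = fun i => g i k := fun k => by simp [hmix]
  have hstep : ∀ k : Fin K, (k + 1, mix (k + 1),
      stepFlags (episodeFlags g k) (fun i => g i k) K k) ∈
        (chain p hp0 hp1 (k, mix k, episodeFlags g k)).support := by
    intro k
    refine (mem_support_chain p hp0 hp1).2 ⟨rfl, ?_, fun n => g' n k, ?_, ?_⟩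
    · simp only [hcol]
    · simpa only [hcol] using h k
    · exact funext fun n => hupd k n
  have hreach : ∀ i (hi : i < K), Leads p hp0 hp1 (0, g, fun _ => false)
      (⟨i, hi⟩, mix i, episodeFlags g i) := by
    intro i
    induction i with
    | zero =>
      intro hi
      have h0 : mix 0 = g := by simp [hmix]
      rw [h0]
      exact Relation.ReflTransGen.refl
    | succ i ih =>
      intro hi
      refine (ih (by omega)).tail ?_
      have hs := hstep ⟨i, by omega⟩
      have hval : (⟨i, by omega⟩ + 1 : Fin K) = ⟨i + 1, hi⟩ :=
        Fin.ext (by rw [val_add_one]; exact Nat.mod_eq_of_lt hi)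
      have hd : ¬ K ∣ i + 1 := fun hd => absurd (Nat.le_of_dvd (Nat.succ_pos i) hd) (by omega)
      rw [hval] at hs
      convert hs using 3
      funext n
      rw [episodeFlags, dif_pos (show i < K by omega), stepFlags, if_neg hd]
  have hK : K - 1 + 1 = K := Nat.succ_pred_eq_of_ne_zero (NeZero.ne K)
  refine (hreach (K - 1) (by omega)).tail ?_
  have hs := hstep ⟨K - 1, by omega⟩
  have hval : (⟨K - 1, by omega⟩ + 1 : Fin K) = 0 :=
    Fin.ext (by rw [val_add_one]; simp [hK])
  rw [hval] at hs
  convert hs using 3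
  · funext n j
    simp [hmix, hK]
  · funext n
    simp [stepFlags, hK]

variable {p hp0 hp1}

/-- In one episode the first entries in the stable contexts before `k` cannot move, while the agents
without an earlier entry may realise any allowed choice in column `k`. All other entries are filled
arbitrarily. -/
theorem exists_leads_column {g : Fin N → Table R K} {k : Fin K}
    (hs : ∀ j < k, StableAt g j) (w : Fin N → Option (Fin R))
    (hw : ∀ n, (∀ i < k, g n i = none) →
      Allowed (episodeFlags g k) (fun i => g i k) n (w n)) :
    ∃ g', Leads p hp0 hp1 (0, g, fun _ => false) (0, g', fun _ => false) ∧ SameFirst k g g' ∧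
      ∀ n, (∀ i < k, g n i = none) → g' n k = w n := by
  classical
  choose v hv using fun (j : Fin K) n => exists_allowed (episodeFlags g j) (fun i => g i j) n
  set g' : Fin N → Table R K := fun n j =>
    if j = k ∧ ∀ i < k, g n i = none then w n else v j n with hg'
  have hall : ∀ (j : Fin K) n, Allowed (episodeFlags g j) (fun i => g i j) n (g' n j) := by
    intro j n
    simp only [hg']
    split_ifs with h
    · obtain ⟨rfl, h⟩ := h
      exact hw n h
    · exact hv j n
  refine ⟨g', leads_episode p hp0 hp1 g g' hall, fun n j hj hn => ?_, fun n hn => ?_⟩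
  · have hcj := consistent_episodeFlags (g := g) j.2.le fun i hi => hs i (lt_trans hi hj)
    exact (hs j hj).allowed_eq hcj ((hcj n).2 hn) (hall j n)
  · exact if_pos ⟨rfl, hn⟩

/-- Greedy extension: an unmatched agent in `A` takes a resource unused by `A`, which lowers the
number of empty entries. -/
theorem exists_maximal_matching (A : Fin N → Prop) (w : Fin N → Option (Fin R))
    (hw : ∀ n n' r, A n → A n' → w n = some r → w n' = some r → n = n') :
    ∃ w' : Fin N → Option (Fin R), (∀ n r, w n = some r → w' n = some r) ∧
      (∀ n n' r, A n → A n' → w' n = some r → w' n' = some r → n = n') ∧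
      ∀ n, A n → w' n = none → ∀ r, ∃ m, A m ∧ w' m = some r := by
  classical
  induction hd : (Finset.univ.filter fun n => w n = none).card using Nat.strong_induction_on
    generalizing w with
  | _ d ih =>
    by_cases hmax : ∀ n, A n → w n = none → ∀ r, ∃ m, A m ∧ w m = some r
    · exact ⟨w, fun _ _ h => h, hw, hmax⟩
    push Not at hmax
    obtain ⟨n, hn, hwn, r, hr⟩ := hmax
    set u := Function.update w n (some r) with hu
    have hun : u n = some r := Function.update_self _ _ _
    have hum : ∀ m, m ≠ n → u m = w m := fun m hm => Function.update_of_ne hm _ _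
    have hlt : (Finset.univ.filter fun m => u m = none).card < d := by
      rw [← hd]
      refine Finset.card_lt_card ⟨fun m hm => ?_, fun hsub => ?_⟩
      · simp only [Finset.mem_filter, Finset.mem_univ, true_and] at hm ⊢
        by_cases hmn : m = n
        · rwa [hmn]
        · rwa [hum m hmn] at hm
      · have := (Finset.mem_filter.1 (hsub (Finset.mem_filter.2 ⟨Finset.mem_univ n, hwn⟩))).2
        rw [hun] at this
        cases this
    have huinj : ∀ m m' q, A m → A m' → u m = some q → u m' = some q → m = m' := by
      intro m m' q hm hm' hq hq'
      by_cases h1 : m = n <;> by_cases h2 : m' = n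
      · rw [h1, h2]
      · rw [h1, hun] at hq
        rw [hum m' h2, ← hq] at hq'
        exact absurd hq' (hr m' hm')
      · rw [h2, hun] at hq'
        rw [hum m h1, ← hq'] at hq
        exact absurd hq (hr m hm)
      · rw [hum m h1] at hq
        rw [hum m' h2] at hq'
        exact hw m m' q hm hm' hq hq'
    obtain ⟨w', h1, h2, h3⟩ := ih _ hlt u huinj rfl
    refine ⟨w', fun m q hm => h1 m q ?_, h2, h3⟩
    have hmn : m ≠ n := by
      rintro rfl
      rw [hwn] at hm
      cases hm
    rwa [hum m hmn]

/-- Once the earlier contexts are stable, so may be the context `k` after some more episodes: if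
nobody accesses, everybody starts to; then all but one of the agents colliding in a resource back
off; then the monitoring agents spread over the free resources. -/
theorem exists_leads_stable {g : Fin N → Table R K} {k : Fin K} (hs : ∀ j < k, StableAt g j) :
    ∃ g', Leads p hp0 hp1 (0, g, fun _ => false) (0, g', fun _ => false) ∧
      ∀ j ≤ k, StableAt g' j := by
  classical
  have hflag : ∀ f : Fin N → Table R K, (∀ j < k, StableAt f j) → ∀ n,
      episodeFlags f k n = false ↔ ∀ i < k, f n i = none :=
    fun f hf => consistent_episodeFlags k.2.le hf
  -- If every agent has an earlier entry, nobody owns or waits for a slot in `k`, and stability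
  -- there is vacuous.
  by_cases hact : ∃ n, ∀ i < k, g n i = none
  swap
  · push Not at hact
    refine ⟨g, Relation.ReflTransGen.refl, fun j hj => ?_⟩
    rcases hj.lt_or_eq with hj | rfl
    · exact hs j hj
    · refine ⟨fun n _ _ hn => ?_, fun n hn => ?_⟩
      · obtain ⟨i, hi, hi'⟩ := hact n
        exact absurd (hn.2 i hi) hi'
      · obtain ⟨i, hi, hi'⟩ := hact n
        exact absurd (hn i hi) hi'
  obtain ⟨n₀, hn₀⟩ := hact
  -- Some resource must be in use, because a monitoring agent can stay empty only by looking at an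
  -- occupied one. If none is, everything is free and all may take resource `0`.
  obtain ⟨g₁, hl₁, hs₁, n₁, r₁, hn₁, hr₁⟩ : ∃ g₁,
      Leads p hp0 hp1 (0, g, fun _ => false) (0, g₁, fun _ => false) ∧
      (∀ j < k, StableAt g₁ j) ∧ ∃ n r, (∀ i < k, g₁ n i = none) ∧ g₁ n k = some r := by
    by_cases hne : ∃ n r, (∀ i < k, g n i = none) ∧ g n k = some r
    · exact ⟨g, Relation.ReflTransGen.refl, hs, hne⟩
    push Not at hne
    obtain ⟨g₁, hl, hsame, hk⟩ := exists_leads_column (p := p) (hp0 := hp0) (hp1 := hp1) hs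
      (fun _ => some 0) fun n hn => by
        refine Or.inr ⟨Option.eq_none_iff_forall_ne_some.2 fun r => hne n r hn,
          Or.inr ⟨0, rfl, ?_⟩⟩
        rintro ⟨j, hj, hj'⟩
        exact hne j 0 ((hflag g hs j).1 hj) hj'
    exact ⟨g₁, hl, fun j hj => hsame.stableAt hj (hs j hj), n₀, 0,
      (hsame.none_iff_lt n₀ le_rfl).2 hn₀, hk n₀ hn₀⟩
  obtain ⟨g₂, hl₂, hs₂, hinj, n₂, r₂, hn₂, hr₂⟩ : ∃ g₂,
      Leads p hp0 hp1 (0, g₁, fun _ => false) (0, g₂, fun _ => false) ∧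
      (∀ j < k, StableAt g₂ j) ∧
      (∀ n n' r, (∀ i < k, g₂ n i = none) → (∀ i < k, g₂ n' i = none) → g₂ n k = some r →
        g₂ n' k = some r → n = n') ∧
      ∃ n r, (∀ i < k, g₂ n i = none) ∧ g₂ n k = some r := by
    -- `κ r` is the one agent who keeps `r`; `n₁` is a dummy value when nobody accesses `r`.
    have hkeep : ∀ r, ∃ n, (∃ m, (∀ i < k, g₁ m i = none) ∧ g₁ m k = some r) →
        (∀ i < k, g₁ n i = none) ∧ g₁ n k = some r := by
      intro r
      by_cases h : ∃ m, (∀ i < k, g₁ m i = none) ∧ g₁ m k = some r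
      · obtain ⟨m, hm⟩ := h
        exact ⟨m, fun _ => hm⟩
      · exact ⟨n₁, fun h' => absurd h' h⟩
    choose κ hκ using hkeep
    set w : Fin N → Option (Fin R) := fun n => (g₁ n k).filter fun r => κ r = n with hw
    have hw' : ∀ n r, w n = some r ↔ g₁ n k = some r ∧ κ r = n := by
      intro n r
      simp [hw, Option.filter_eq_some_iff]
    obtain ⟨g₂, hl, hsame, hk⟩ := exists_leads_column (p := p) (hp0 := hp0) (hp1 := hp1) hs₁
      w fun n hn => by
        rcases hg : g₁ n k with _ | r
        · refine Or.inr ⟨hg, Or.inl ⟨by simp [hw, hg], r₁, n₁, (hflag g₁ hs₁ n₁).2 hn₁, hr₁⟩⟩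
        · refine Or.inl ⟨r, hg, ?_⟩
          by_cases hκn : κ r = n
          · exact Or.inl ((hw' n r).2 ⟨hg, hκn⟩)
          · obtain ⟨h1, h2⟩ := hκ r ⟨n, hn, hg⟩
            exact Or.inr ⟨by simp [hw, hg, hκn], (hflag g₁ hs₁ n).2 hn, κ r, hκn,
              (hflag g₁ hs₁ _).2 h1, h2⟩
    refine ⟨g₂, hl, fun j hj => hsame.stableAt hj (hs₁ j hj), ?_, ?_⟩
    · intro n n' r hn hn' hr hr'
      rw [hsame.none_iff_lt _ le_rfl] at hn hn'
      rw [hk n hn] at hr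
      rw [hk n' hn'] at hr'
      rw [← ((hw' n r).1 hr).2, ((hw' n' r).1 hr').2]
    · obtain ⟨h1, h2⟩ := hκ r₁ ⟨n₁, hn₁, hr₁⟩
      exact ⟨κ r₁, r₁, (hsame.none_iff_lt _ le_rfl).2 h1,
        (hk _ h1).trans ((hw' _ _).2 ⟨h2, rfl⟩)⟩
  -- Accesses are now free of collisions. A maximal extension uses only resources free in `g₂`, and
  -- those left empty may monitor the occupied `r₂`.
  obtain ⟨w, hext, hwinj, hmax⟩ := exists_maximal_matching
    (fun n => ∀ i < k, g₂ n i = none) (fun n => g₂ n k) hinj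
  obtain ⟨g₃, hl₃, hsame, hk⟩ := exists_leads_column (p := p) (hp0 := hp0) (hp1 := hp1) hs₂ w
    fun n hn => by
      rcases hg : g₂ n k with _ | r
      · refine Or.inr ⟨hg, ?_⟩
        rcases hwn : w n with _ | r
        · exact Or.inl ⟨rfl, r₂, n₂, (hflag g₂ hs₂ n₂).2 hn₂, hr₂⟩
        · refine Or.inr ⟨r, rfl, ?_⟩
          rintro ⟨m, hm, hm'⟩
          have hmn := hwinj m n r ((hflag g₂ hs₂ m).1 hm) hn (hext m r hm') hwn
          subst hmn
          exact Option.some_ne_none r (hm'.symm.trans hg)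
      · exact Or.inl ⟨r, hg, Or.inl (hext n r hg)⟩
  refine ⟨g₃, (hl₁.trans hl₂).trans hl₃, fun j hj => ?_⟩
  rcases hj.lt_or_eq with hj | rfl
  · exact hsame.stableAt hj (hs₂ j hj)
  · have hnone := fun n => hsame.none_iff_lt n (j := j) le_rfl
    refine ⟨fun n n' r hn hn' => ?_, fun n hn hn' r => ?_⟩
    · have h1 := (hnone n).1 hn.2
      have h2 := (hnone n').1 hn'.2
      exact hwinj n n' r h1 h2 ((hk n h1).symm.trans hn.1) ((hk n' h2).symm.trans hn'.1)
    · have h1 := (hnone n).1 hn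
      obtain ⟨m, hm, hm'⟩ := hmax n h1 ((hk n h1).symm.trans hn') r
      exact ⟨m, (hk m hm).trans hm', (hnone m).2 hm⟩

theorem exists_leads_allStable (g : Fin N → Table R K) {k : ℕ} (hk : k ≤ K) :
    ∃ g', Leads p hp0 hp1 (0, g, fun _ => false) (0, g', fun _ => false) ∧
      ∀ j : Fin K, (j : ℕ) < k → StableAt g' j := by
  induction k with
  | zero => exact ⟨g, Relation.ReflTransGen.refl, fun j hj => absurd hj (Nat.not_lt_zero _)⟩
  | succ k ih =>
    obtain ⟨g₁, hl₁, hs₁⟩ := ih (by omega)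
    obtain ⟨g₂, hl₂, hs₂⟩ := exists_leads_stable (p := p) (hp0 := hp0) (hp1 := hp1)
      (g := g₁) (k := ⟨k, hk⟩) fun j hj => hs₁ j hj
    exact ⟨g₂, hl₁.trans hl₂, fun j hj => hs₂ j (Nat.lt_succ_iff.1 hj)⟩

/-- The contexts provide enough slots for all agents. -/
theorem exists_entry_of_stable (hN : N ≤ K * R) {g : Fin N → Table R K}
    (hs : ∀ j, StableAt g j) (n : Fin N) : ∃ j, g n j ≠ none := by
  by_contra h
  push Not at h
  choose own hown using fun x : Fin K × Fin R => (hs x.1).2 n (fun i _ => h i) (h x.1) x.2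
  -- An agent with an empty table would force an owner for each of the `K * R` slots. An owner has
  -- only one first entry, so these owners are distinct and differ from `n`: that makes `K * R + 1`
  -- agents.
  have hinj : Function.Injective fun x : Option (Fin K × Fin R) => x.elim n own := by
    have hne : ∀ x, own x ≠ n := fun x hx => by
      have := (hown x).1
      rw [hx, h] at this; cases this
    rintro (_ | ⟨j, r⟩) (_ | ⟨j', r'⟩) hxy
    · rfl
    · exact absurd hxy.symm (hne _)
    · exact absurd hxy (hne _)
    · have h1 := hown (j, r)
      have h2 := hown (j', r')
      simp only [Option.elim_some] at hxy
      rw [hxy] at h1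
      simp only [Owns] at h1 h2
      rcases lt_trichotomy j j' with hj | rfl | hj
      · have := h2.2 j hj
        rw [h1.1] at this; cases this
      · rw [h1.1, Option.some_inj] at h2
        rw [h2.1]
      · have := h1.2 j' hj
        rw [h2.1] at this; cases this
  have hcard := Fintype.card_le_of_injective _ hinj
  simp only [Fintype.card_option, Fintype.card_prod, Fintype.card_fin] at hcard
  omega

theorem exists_leads_start (x : Fin K × (Fin N → Table R K) × (Fin N → Bool)) :
    ∃ g, Leads p hp0 hp1 x (0, g, fun _ => false) := by
  obtain ⟨d, hd⟩ : ∃ d, (x.1 : ℕ) + 1 + d = K := ⟨K - (x.1 + 1), by omega⟩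
  induction d generalizing x with
  | zero =>
    obtain ⟨y, hy⟩ := (chain p hp0 hp1 x).support_nonempty
    obtain ⟨h1, h2, -⟩ := (mem_support_chain p hp0 hp1).1 hy
    obtain ⟨k, g, acc⟩ := y
    have hk : k = 0 := Fin.ext (by
      rw [show k = x.1 + 1 from h1, val_add_one]
      simp [show (x.1 : ℕ) + 1 = K from hd])
    have hacc : acc = fun _ => false := by
      rw [show acc = _ from h2]
      funext n
      simp [stepFlags, show (x.1 : ℕ) + 1 = K from hd]
    subst hk hacc
    exact ⟨g, Relation.ReflTransGen.single hy⟩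
  | succ d ih =>
    obtain ⟨y, hy⟩ := (chain p hp0 hp1 x).support_nonempty
    have h1 := ((mem_support_chain p hp0 hp1).1 hy).1
    obtain ⟨g, hg⟩ := ih y (by
      rw [h1, val_add_one, Nat.mod_eq_of_lt (by omega)]; omega)
    exact ⟨g, Relation.ReflTransGen.head hy hg⟩

theorem exists_leads_settled (hN : N ≤ K * R)
    (x : Fin K × (Fin N → Table R K) × (Fin N → Bool)) :
    ∃ y, Settled y ∧ Leads p hp0 hp1 x y := by
  obtain ⟨g, hg⟩ := exists_leads_start (p := p) (hp0 := hp0) (hp1 := hp1) x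
  obtain ⟨g', hg', hs⟩ := exists_leads_allStable (p := p) (hp0 := hp0) (hp1 := hp1) g le_rfl
  refine ⟨_, ⟨fun j => hs j j.2, exists_entry_of_stable hN fun j => hs j j.2, fun n => ?_⟩,
    hg.trans hg'⟩
  simp

end Reach

/-! ### The payoff of the courteous strategy -/

section Courteous

variable {N R K : ℕ} [NeZero R] [NeZero K] {p : ℝ} {hp0 : 0 < p} {hp1 : p < 1}

theorem context_succ (t : ℕ) : context K (t + 1) = context K t + 1 :=
  Fin.ext (by rw [val_add_one]; exact (Nat.mod_add_mod t K 1).symm)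

theorem nextFlags_context (t : ℕ) (acc : Fin N → Bool) (a : Fin N → Move R) :
    nextFlags K (context K t) acc a = nextFlags K t acc a := by
  have h : K ∣ (context K t : ℕ) + 1 ↔ K ∣ t + 1 := by
    rw [Nat.dvd_iff_mod_eq_zero, Nat.dvd_iff_mod_eq_zero, ← Nat.mod_add_mod t K 1]
    rfl
  funext n
  by_cases hd : K ∣ t + 1
  · rw [nextFlags_of_dvd hd, nextFlags_of_dvd (h.2 hd)]
  · by_cases hs : feedback a n = Feedback.success
    · rw [nextFlags_of_success hd hs, nextFlags_of_success (fun hd' => hd (h.1 hd')) hs]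
    · rw [nextFlags_of_not_success hd hs, nextFlags_of_not_success (fun hd' => hd (h.1 hd')) hs]

theorem mem_support_chain_of_moves {t : ℕ} {m m' : Fin N → Table R K} {acc : Fin N → Bool}
    {a : Fin N → Move R} (ha : a ∈ (moveLaw p hp0 hp1 (context K t) m acc).support)
    (hm : m' ∈ (tableLaw p hp0 hp1 (context K t) m a).support) :
    (context K (t + 1), m', nextFlags K t acc a) ∈
      (chain p hp0 hp1 (context K t, m, acc)).support := by
  rw [chain, PMF.mem_support_bind_iff]
  refine ⟨a, ha, (PMF.mem_support_map_iff _ _ _).2 ⟨m', hm, ?_⟩⟩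
  rw [context_succ, nextFlags_context]

theorem expect_chain {f : Fin K × (Fin N → Table R K) × (Fin N → Bool) → ℝ} {H : ℝ}
    (hf : ∀ x, |f x| ≤ H) (t : ℕ) (m : Fin N → Table R K) (acc : Fin N → Bool) :
    expect (chain p hp0 hp1 (context K t, m, acc)) f =
      expect (moveLaw p hp0 hp1 (context K t) m acc) fun a =>
        expect (tableLaw p hp0 hp1 (context K t) m a) fun m' =>
          f (context K (t + 1), m', nextFlags K t acc a) := by
  rw [chain, expect_bind _ _ hf]
  simp only [expect_map _ _ hf, context_succ, nextFlags_context]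

/-- Accesses never collide in a settled state. A success still due cannot be missed at the last
step, since the agent's first entry would then have to lie in the current context. -/
theorem Settled.payoff {ζ : ℝ} {t : ℕ} {m : Fin N → Table R K} {acc : Fin N → Bool}
    (hx : Settled (context K t, m, acc)) {a : Fin N → Move R}
    (ha : a ∈ (moveLaw p hp0 hp1 (context K t) m acc).support) (n : Fin N) :
    0 ≤ stagePayoff ζ a n ∧ (acc n = false →
      1 ≤ stagePayoff ζ a n ∨ (¬ K ∣ t + 1 ∧ nextFlags K t acc a n = false)) := by
  obtain ⟨hs, he, hc⟩ := hx
  dsimp only at hs he hc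
  have hma := (mem_support_moveLaw p hp0 hp1).1 ha
  by_cases hsuc : feedback a n = Feedback.success
  · rw [stagePayoff_of_success hsuc]
    exact ⟨zero_le_one, fun _ => Or.inl le_rfl⟩
  · have hns := fun h => hsuc ((feedback_success_iff hma n).2 (((hs _).succeeds_iff hc n).2 h))
    have h0 : stagePayoff ζ a n = 0 := stagePayoff_eq_zero fun r hr => by
      obtain ⟨h1, h2⟩ := (access_iff hma n r).1 hr
      exact hns ⟨h1, by rw [h2]; exact Option.some_ne_none r⟩
    refine ⟨h0.ge, fun hn => Or.inr ?_⟩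
    have hd : ¬ K ∣ t + 1 := by
      intro hd
      obtain ⟨j, hj⟩ := he n
      have hlast : t % K + 1 = K := (mod_add_one_of_dvd (NeZero.ne K) hd).1
      have hctx : ((context K t : Fin K) : ℕ) = t % K := rfl
      rcases Nat.lt_or_ge (j : ℕ) (context K t) with hlt | hge
      · exact hj ((hc n).1 hn j hlt)
      · have hjk : j = context K t := Fin.ext (by omega)
        rw [hjk] at hj
        exact hns ⟨hn, hj⟩
    exact ⟨hd, (nextFlags_of_not_success hd hsuc).trans hn⟩

/-- Up to a bounded loss, courteous agents have one success in every episode. -/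
theorem exists_le_expectedPayoff_courteous (hN : N ≤ K * R) (hp0 : 0 < p) (hp1 : p < 1)
    {ζ : ℝ} (hζ : ζ < 0) : ∃ C : ℝ, ∀ δ : ℝ, 0 < δ → δ < 1 →
      ∀ (n : Fin N) (s : ℕ) (acc : Fin N → Bool) (ι : Fin N → PMF (Table R K)),
        δ ^ K * (δ ^ (K - 1) * (1 / (1 - δ ^ K))) - C ≤
          expectedPayoff ζ δ s acc (fun i => courteousFrom p hp0.le hp1.le (ι i)) n := by
  obtain ⟨h, H, h0, hH, hG, hdrift⟩ := exists_lyapunov (chain (N := N) (R := R) (K := K) p hp0 hp1)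
    {x | Settled x} fun x => exists_leads_settled hN x
  have hb : ∀ x, |h x| ≤ H := fun x => (abs_of_nonneg (h0 x)).trans_le (hH x)
  have hζ' : 0 < 1 - ζ := by linarith
  refine ⟨(1 - ζ) * H, fun δ hδ0 hδ1 n s acc ι => ?_⟩
  set V := 1 + 1 / (1 - δ ^ K) with hV
  have hlate : ∀ t flag, |lateValue K δ t flag| ≤ V := fun t flag => by
    have hl := le_lateValue (K := K) hδ0 hδ1 t flag
    have hu := (lateValue_le_earlyValue (K := K) hδ0 hδ1 t flag).trans
      (earlyValue_le hδ0 hδ1 t flag)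
    have hv := episodes_value_nonneg (K := K) hδ0 hδ1
    rwa [abs_of_nonneg (le_trans (by positivity) hl)]
  -- The term `(1 - ζ) * h` pays in advance for the steps until settling; it vanishes on settled
  -- states.
  set W : ℕ → (Fin N → Table R K) → (Fin N → Bool) → ℝ := fun t m a =>
    lateValue K δ t (a n) - (1 - ζ) * h (context K t, m, a) with hWdef
  have hWB : ∀ t m a, |W t m a| ≤ V + (1 - ζ) * H := fun t m a => by
    refine (abs_sub _ _).trans (add_le_add (hlate _ _) ?_)
    rw [abs_mul, abs_of_pos hζ']
    exact mul_le_mul_of_nonneg_left (hb _) hζ'.le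
  have hstep : ∀ t m a, W t m a ≤ expect (moveLaw p hp0 hp1 (context K t) m a) fun b =>
      stagePayoff ζ b n + δ * expect (tableLaw p hp0 hp1 (context K t) m b) fun m' =>
        W (t + 1) m' (nextFlags K t a b) := by
    intro t m a
    have hFB : ∀ b, |stagePayoff ζ b n + δ * expect (tableLaw p hp0 hp1 (context K t) m b)
        fun m' => W (t + 1) m' (nextFlags K t a b)| ≤ (1 - ζ) + δ * (V + (1 - ζ) * H) := by
      intro b
      refine (abs_add_le _ _).trans (add_le_add (abs_stagePayoff_le hζ b n) ?_)
      rw [abs_mul, abs_of_pos hδ0]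
      exact mul_le_mul_of_nonneg_left (abs_expect_le _ fun m' => hWB _ _ _) hδ0.le
    by_cases hset : Settled (context K t, m, a)
    · have hW0 : W t m a = lateValue K δ t (a n) := by simp [hWdef, hG _ hset]
      rw [hW0]
      refine le_expect _ hFB fun b hbs => ?_
      have hnext : lateValue K δ (t + 1) (nextFlags K t a b n) ≤
          expect (tableLaw p hp0 hp1 (context K t) m b) fun m' =>
            W (t + 1) m' (nextFlags K t a b) := by
        refine le_expect _ (fun m' => hWB _ _ _) fun m' hm' => ?_
        have := hG _ (hset.chain (mem_support_chain_of_moves hbs hm'))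
        simp [hWdef, this]
      obtain ⟨hpay, hpay'⟩ := hset.payoff (ζ := ζ) hbs n
      have := lateValue_step_of_settled hδ0 hδ1 (t := t) (flag := a n)
        (flag' := nextFlags K t a b n) (fun hd => nextFlags_of_dvd hd n) hpay hpay'
      linarith [mul_le_mul_of_nonneg_left hnext hδ0.le]
    · set E : (Fin N → Move R) → ℝ := fun b => expect (tableLaw p hp0 hp1 (context K t) m b)
        fun m' => h (context K (t + 1), m', nextFlags K t a b) with hE
      have hEb : ∀ b, |E b| ≤ H := fun b => abs_expect_le _ fun m' => hb _
      have hE0 : 0 ≤ expect (moveLaw p hp0 hp1 (context K t) m a) E :=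
        le_expect _ hEb fun b _ => le_expect _ (fun m' => hb _) fun m' _ => h0 _
      have hd := hdrift _ hset
      rw [expect_chain hb] at hd
      set A := lateValue K δ t (a n) - (1 - ζ) with hA
      have hlin := expect_mul_add_mul (moveLaw p hp0 hp1 (context K t) m a)
        (f := fun _ => A) (g := E) (fun _ => le_rfl) hEb 1 (-(δ * (1 - ζ)))
      have hle : expect (moveLaw p hp0 hp1 (context K t) m a)
          (fun b => 1 * A + -(δ * (1 - ζ)) * E b) ≤ expect (moveLaw p hp0 hp1 (context K t) m a)
          fun b => stagePayoff ζ b n + δ * expect (tableLaw p hp0 hp1 (context K t) m b) fun m' =>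
            W (t + 1) m' (nextFlags K t a b) := by
        refine expect_mono _ (C := (1 - ζ) + δ * (V + (1 - ζ) * H))
          (B := |A| + δ * (1 - ζ) * H) (fun b => ?_) hFB fun b _ => ?_
        · refine (abs_add_le _ _).trans (add_le_add (by rw [one_mul]) ?_)
          rw [abs_mul, abs_neg, abs_of_pos (by positivity)]
          exact mul_le_mul_of_nonneg_left (hEb b) (by positivity)
        · have hin := expect_mul_add_mul (tableLaw p hp0 hp1 (context K t) m b)
            (f := fun _ => lateValue K δ (t + 1) (nextFlags K t a b n))
            (g := fun m' => h (context K (t + 1), m', nextFlags K t a b))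
            (fun _ => le_rfl) (fun _ => hb _) 1 (-(1 - ζ))
          have hin' : (expect (tableLaw p hp0 hp1 (context K t) m b) fun m' =>
              W (t + 1) m' (nextFlags K t a b)) =
              lateValue K δ (t + 1) (nextFlags K t a b n) - (1 - ζ) * E b := by
            rw [expect_const] at hin
            rw [hE, sub_eq_add_neg, ← neg_mul, ← one_mul (lateValue K δ _ _), ← hin]
            congr 1
            funext m'
            simp only [hWdef]
            ring
          rw [hin']
          have := lateValue_step_of_le hδ0 hδ1 (t := t) (flag := a n)
            (flag' := nextFlags K t a b n) (fun hd => nextFlags_of_dvd hd n)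
            (le_stagePayoff hζ b n)
          simp only [hA]
          linarith
      refine le_trans ?_ hle
      rw [hlin, expect_const]
      simp only [hWdef, hA]
      -- The drift is undiscounted; as `E` has nonnegative mean, the factor `δ ≤ 1` only helps.
      -- Hence the constant does not depend on `δ`.
      have h1 : 1 + δ * expect (moveLaw p hp0 hp1 (context K t) m a) E ≤ h (context K t, m, a) := by
        have := mul_le_of_le_one_left hE0 hδ1.le
        linarith
      linarith [mul_le_mul_of_nonneg_left h1 hζ'.le]
  have hc : ∀ x : Stage (fun i => courteousFrom p hp0.le hp1.le (ι i)),
      |stagePayoff ζ x.moves n| ≤ 1 - ζ := fun x => abs_stagePayoff_le hζ _ _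
  have key := expect_le_integral_discounted (fun i => courteousFrom p hp0.le hp1.le (ι i)) s acc hc
    hδ0.le hδ1 (W := W) (B := V + (1 - ζ) * H) hWB fun t m a => by
      refine (hstep t m a).trans_eq ?_
      rw [chooseMoves, expect_map (B := (1 - ζ) + δ * (V + (1 - ζ) * H))]
      -- The initial law `ι` enters neither the moves nor the updates.
      · rfl
      · intro x
        refine (abs_add_le _ _).trans (add_le_add (hc x) ?_)
        rw [abs_mul, abs_of_pos hδ0]
        exact mul_le_mul_of_nonneg_left (abs_expect_le _ fun m' => hWB _ _ _) hδ0.le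
  refine le_trans ?_ key
  refine le_expect _ (fun m => hWB _ _ _) fun m _ => ?_
  exact sub_le_sub (le_lateValue hδ0 hδ1 _ _) (mul_le_mul_of_nonneg_left (hH _) hζ'.le)

/-- A profile that earns close to one success per episode is an approximate best response. -/
theorem isApproxBestResponse_of_lt {ζ δ ε : ℝ} (hζ : ζ < 0) (hδ0 : 0 < δ) (hδ1 : δ < 1) {s : ℕ}
    {acc : Fin N → Bool} {σ : Fin N → Strategy R K} {n : Fin N}
    (hpos : 0 < expectedPayoff ζ δ s acc σ n)
    (hlt : (1 - ε) * (1 + 1 / (1 - δ ^ K)) < expectedPayoff ζ δ s acc σ n) :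
    IsApproxBestResponse ζ δ ε s acc σ n := by
  have hmem : expectedPayoff ζ δ s acc σ n ∈ Set.range fun τ : Strategy R K =>
      expectedPayoff ζ δ s acc (Function.update σ n τ) n :=
    ⟨σ n, by simp only [Function.update_eq_self]⟩
  have hub : 1 + 1 / (1 - δ ^ K) ∈ upperBounds (Set.range fun τ : Strategy R K =>
      expectedPayoff ζ δ s acc (Function.update σ n τ) n) := by
    rintro _ ⟨τ, rfl⟩
    exact expectedPayoff_le hδ0 hδ1 hζ _ _ _ _
  have hlub := isLUB_csSup ⟨_, hmem⟩ ⟨_, hub⟩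
  refine ⟨_, hlub, ?_⟩
  -- For `ε > 1` the factor is negative, and the claim follows from the positivity of the payoff
  -- instead.
  rcases le_total 0 (1 - ε) with h | h
  · exact (mul_le_mul_of_nonneg_left (hlub.2 hub) h).trans_lt hlt
  · exact (mul_nonpos_of_nonpos_of_nonneg h (hpos.le.trans (hlub.1 hmem))).trans_lt hpos

/-- Multiplied by `1 - δ ^ K`, both inequalities say that a continuous function of `δ` is positive.
At `δ = 1` the two functions are `1` and `ε`, so they stay positive nearby. -/
theorem exists_discount (K : ℕ) [NeZero K] (C : ℝ) {ε : ℝ} (hε : 0 < ε) :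
    ∃ δ₀ : ℝ, 0 < δ₀ ∧ δ₀ < 1 ∧ ∀ δ : ℝ, δ₀ ≤ δ → δ < 1 →
      0 < δ ^ K * (δ ^ (K - 1) * (1 / (1 - δ ^ K))) - C ∧
      (1 - ε) * (1 + 1 / (1 - δ ^ K)) < δ ^ K * (δ ^ (K - 1) * (1 / (1 - δ ^ K))) - C := by
  have hpos : ∀ {f : ℝ → ℝ}, Continuous f → 0 < f 1 → ∀ᶠ δ in nhds 1, 0 < f δ :=
    fun hf h => hf.continuousAt.tendsto.eventually (lt_mem_nhds h)
  have h1 := hpos (f := fun δ => δ ^ K * δ ^ (K - 1) - C * (1 - δ ^ K)) (by fun_prop) (by simp)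
  have h2 := hpos
    (f := fun δ => δ ^ K * δ ^ (K - 1) - C * (1 - δ ^ K) - (1 - ε) * (1 - δ ^ K + 1))
    (by fun_prop) (by simpa using hε)
  obtain ⟨η, hη, hball⟩ := Metric.eventually_nhds_iff.1 (h1.and h2)
  refine ⟨max (1 / 2) (1 - η / 2), by positivity, by rw [max_lt_iff]; constructor <;> linarith,
    fun δ hδ hδ1 => ?_⟩
  obtain ⟨hδa, hδb⟩ := max_le_iff.1 hδ
  have hδ0 : 0 < δ := by linarith
  have hsub := one_sub_pow_pos (K := K) hδ0 hδ1
  obtain ⟨hA, hB⟩ := hball (y := δ) (by rw [Real.dist_eq, abs_lt]; constructor <;> linarith)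
  have hv := one_div_pos.2 hsub
  have hmul : (1 - δ ^ K) * (1 / (1 - δ ^ K)) = 1 := mul_one_div_cancel hsub.ne'
  constructor
  · have := mul_pos hA hv
    linear_combination this - C * hmul
  · have := mul_pos hB hv
    linear_combination this - (C + (1 - ε)) * hmul

end Courteous

end Allocation

end

/-- First conjunct: the game from its beginning, with uniformly random initial tables. Second
conjunct: every subgame, i.e. the play from any time `s` on, whatever the quota flags and the tables
`g i` of the agents are after the past history. -/
theorem mainTheorem1 (N R K : ℕ) [NeZero R] [NeZero K] (hK : K = ⌈(N : ℝ) / (R : ℝ)⌉₊)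
    (ζ : ℝ) (hζ : ζ < 0) (p : ℝ) (hp0 : 0 < p) (hp1 : p < 1) (ε : ℝ) (hε : 0 < ε) :
    ∃ δ₀ : ℝ, 0 < δ₀ ∧ δ₀ < 1 ∧ ∀ δ : ℝ, δ₀ ≤ δ → δ < 1 → ∀ n : Fin N,
      Allocation.IsApproxBestResponse ζ δ ε 0 (fun _ => false)
        (fun _ : Fin N => Allocation.courteous R K p hp0.le hp1.le) n ∧
      ∀ (s : ℕ) (accessed : Fin N → Bool) (g : Fin N → Allocation.Table R K),
        Allocation.IsApproxBestResponse ζ δ ε s accessed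
          (fun i : Fin N => Allocation.courteousFrom p hp0.le hp1.le (PMF.pure (g i))) n := by
  have hR : (0 : ℝ) < R := Nat.cast_pos.2 (Nat.pos_of_ne_zero (NeZero.ne R))
  have hN : N ≤ K * R := by
    have h : (N : ℝ) / R ≤ K := hK ▸ Nat.le_ceil _
    rw [div_le_iff₀ hR] at h
    exact_mod_cast h
  obtain ⟨C, hC⟩ := Allocation.exists_le_expectedPayoff_courteous hN hp0 hp1 hζ
  obtain ⟨δ₀, h0, h1, hδ₀⟩ := Allocation.exists_discount K C hε
  refine ⟨δ₀, h0, h1, fun δ hδ hδ1 n => ?_⟩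
  have hδ0 := h0.trans_le hδ
  obtain ⟨hpos, hlt⟩ := hδ₀ δ hδ hδ1
  -- The bounds are uniform in the starting time, the flags and the initial law of the tables, so
  -- one `δ₀` serves the whole game and every continuation.
  have hmain : ∀ (s : ℕ) (acc : Fin N → Bool) (ι : Fin N → PMF (Allocation.Table R K)),
      Allocation.IsApproxBestResponse ζ δ ε s acc
        (fun i => Allocation.courteousFrom p hp0.le hp1.le (ι i)) n := fun s acc ι =>
    Allocation.isApproxBestResponse_of_lt hζ hδ0 hδ1 (hpos.trans_le (hC δ hδ0 hδ1 n s acc ι))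
      (hlt.trans_le (hC δ hδ0 hδ1 n s acc ι))
  exact ⟨hmain 0 _ fun _ => PMF.uniformOfFintype _,
    fun s acc g => hmain s acc fun i => PMF.pure (g i)⟩
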